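/- **Conventions.** A *Radon space* is a topological space homeomorphic to a universally measurable subset of a compact metrizable space. For a Radon space $E$ let $E_\Delta = E\cup\{\Delta\}$ with an isolated cemetery point $\Delta\notin E$; $\mathcal E$ is the universal completion of the Borel $\sigma$-algebra, and every function $f$ on $E$ is extended by $f(\Delta)=0$. For a process $Z$ with values in $E_\Delta$ let $\zeta=\inf\{t\ge 0: Z_t=\Delta\}$. A *family of shift operators* for $Z$ is $(\Theta_t)_{t\in[0,\infty]}$, $\Theta_t\colon\Omega\to\Omega$, with $Z_s\circ\Theta_t=Z_{s+t}$ for $s,t<\infty$ and $\Theta_\infty\equiv[\Delta]$ for some dead path $[\Delta]\in\Omega$, i.e. $\zeta([\Delta])=0$. "A.s." means $\mathbb P_x$-a.s. for all $x\in E$. The *augmentation* of a sub-$\sigma$-algebra $\mathcal A\subseteq\mathcal F$ relative to a family $(\mathbb P_x)_{x\in E}$ of probability measures on $(\Omega,\mathcal F)$ is the $\sigma$-algebra of all $A\in\mathcal F$ such that for every finite Borel measure $\mu$ on $E$ there is $B\in\mathcal A$ with $\mathbb P_x(A\,\triangle\,B)=0$ for $\mu$-a.e. $x$. The *natural filtration*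 of $Z$ is the augmentation of $\sigma(Z_s, s\le t)$, $t\ge0$, with $E_\Delta$ carrying its universally completed Borel $\sigma$-algebra. A *right process* on $E$ is a tuple $(\Omega,\mathcal F,(\mathcal F_t)_{t\ge0},(Z_t)_{t\ge 0},(\Theta_t)_t,(\mathbb P_x)_{x\in E})$ such that - $Z$ is a right continuous $E_\Delta$-valued process adapted to $(\mathcal F_t)$, with shift operators $(\Theta_t)$, and $Z_t=\Delta$ for all $t\ge\zeta$; - each $\mathbb P_x$ is a probability measure on $(\Omega,\mathcal F)$ with $\mathbb P_x(Z_0=x)=1$, and $x\mapsto\mathbb P_x(Z_t\in B)$ is $\mathcal E$-measurable for all $t\ge0$, $B\in\mathcal E$; - (Markov property) $\mathbb E_x(f(Z_{s+t})\mid\mathcal F_s)=T_tf(Z_s)$ $\mathbb P_x$-a.s. for all $x\in E$, $s,t\ge0$ and bounded $\mathcal E$-measurable $f$, where $T_tf(y):=\mathbb E_y(f(Z_t))$; - $(\mathcal F_t)$ is right continuous and equal to its augmentation; - for every $\alpha>0$ and every $\alpha$-excessive $f$ (an $\mathcal E$-measurable $f\colon E\to[0,\infty]$ with $e^{-\alpha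 t}T_tf\uparrow f$ pointwise as $t\downarrow0$), the map $t\mapsto f(Z_t)$ is a.s. right continuous. A *terminal time* is an $(\mathcal F_t)$-stopping time $T\colon\Omega\to[0,\infty]$ with $t+T\circ\Theta_t=T$ on $\{t<T\}$ for all $t\ge0$. **Lemma.** Let $(X_t)_{t\ge0}$ be a right continuous stochastic process on a measurable space $(\Omega,\mathcal F)$ with values in $E_\Delta$, $E$ a Radon space; let $(\mathbb P_x)_{x\in E}$ be probability measures on $(\Omega,\mathcal F)$, let $(R^n)_{n\in\mathbb N}$ be an increasing sequence of random times with values in $[0,\infty]$, $R:=\sup_nR^n$, and let $(E^{R,n})_{n\in\mathbb N}$ be an increasing sequence of subspaces of $E$ which are Radon spaces. Put $$X^{R,n}_t=\begin{cases}X_t,&t<R^n,\\ \Delta,&t\ge R^n,\end{cases}\qquad X^R_t=\begin{cases}X_t,&t<R,\\ \Delta,&t\ge R.\end{cases}$$ Let $(\mathcal F^R_t)_{t\ge0}$ be the natural filtration of $X^R$ and let $(\Theta^R_t)$ be an arbitrary family of shift operators for $X^R$. Assume: 1. each $R^n$ is a stopping time over $(\mathcal F^R_t)_{t\ge0}$;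 2. $\bigcup_nE^{R,n}=E$; 3. for each $n$ there are a filtration $(\mathcal F^{R,n}_t)_{t\ge0}$ on $(\Omega,\mathcal F)$ and operators $(\Theta^{R,n}_t)$ on $\Omega$ such that $(\Omega,\mathcal F,(\mathcal F^{R,n}_t),(X^{R,n}_t),(\Theta^{R,n}_t),(\mathbb P_x)_{x\in E^{R,n}})$ is a right process on $E^{R,n}$ (in particular $X^{R,n}$ takes values in $E^{R,n}\cup\{\Delta\}$); 4. for each $n$, $R^n$ is a terminal time for this process $X^{R,n}$, and $R^n>0$ $\mathbb P_x$-a.s. for all $x\in E^{R,n}$. Then $(\Omega,\mathcal F,(\mathcal F^R_t)_{t\ge0},(X^R_t)_{t\ge0},(\Theta^R_t),(\mathbb P_x)_{x\in E})$ is a right process on $E$. -/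

import Mathlib

open MeasureTheory Filter Topology Set
open scoped NNReal ENNReal

namespace RightProc

universe u v

/-! ## State spaces -/

/-- The universal completion of the Borel `σ`-algebra: a set is measurable iff it belongs to the
`μ`-completion of the Borel `σ`-algebra for every finite Borel measure `μ`. -/
@[reducible]
def univBorel (α : Type u) [TopologicalSpace α] : MeasurableSpace α where
  MeasurableSet' s := ∀ μ : @Measure α (borel α),
    @IsFiniteMeasure α (borel α) μ → @NullMeasurableSet α (borel α) s μ
  measurableSet_empty := fun μ _ => @nullMeasurableSet_empty α (borel α) μ
  measurableSet_compl := fun _ hs μ hμ => @NullMeasurableSet.compl α (borel α) μ _ (hs μ hμ)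
  measurableSet_iUnion := fun _ hs μ hμ =>
    let _ : MeasurableSpace α := borel α
    NullMeasurableSet.iUnion fun i => hs i μ hμ

/-- A (metrizable) Radon space: a topological space homeomorphic to a universally measurable
subset of a compact metrizable space. -/
def IsRadonSpace (E : Type u) [TopologicalSpace E] : Prop :=
  ∃ (K : Type u) (_ : TopologicalSpace K) (_ : CompactSpace K)
    (_ : TopologicalSpace.MetrizableSpace K) (φ : E → K),
    IsEmbedding φ ∧ MeasurableSet[univBorel K] (range φ)

/-- `E` together with an isolated cemetery point `Δ` (topological sum). -/
abbrev WithCemetery (E : Type u) : Type u := E ⊕ Unit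

/-- The cemetery point `Δ`. -/
def cemetery {E : Type u} : WithCemetery E := Sum.inr ()

/-- The extension of a function on `E` by the convention `f Δ = 0`. -/
def extendZero {E : Type u} {β : Type*} [Zero β] (f : E → β) : WithCemetery E → β :=
  Sum.elim f fun _ => 0

/-! ## Processes, lifetimes, killing, shifts -/

section Definitions

variable {Ω : Type v} {E : Type u}

/-- The lifetime `ζ = inf {t ≥ 0 : X_t = Δ}`. -/
noncomputable def lifetime (X : ℝ≥0 → Ω → WithCemetery E) (ω : Ω) : ℝ≥0∞ :=
  ⨅ (t : ℝ≥0) (_ : X t ω = cemetery), (t : ℝ≥0∞)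

open Classical in
/-- The process `X` killed at the random time `R`. -/
noncomputable def kill (X : ℝ≥0 → Ω → WithCemetery E) (R : Ω → ℝ≥0∞) :
    ℝ≥0 → Ω → WithCemetery E :=
  fun t ω => if (t : ℝ≥0∞) < R ω then X t ω else cemetery

/-- `(Θ_t, t ∈ [0, ∞])` is a family of shift operators for `X`: `X_s ∘ Θ_t = X_{s+t}` for
`s, t < ∞`, and `Θ_∞ = [Δ]` for a dead path `[Δ]`, i.e. a point of `Ω` with `ζ [Δ] = 0`. -/
structure IsShiftFamily (X : ℝ≥0 → Ω → WithCemetery E) (Θ : ℝ≥0∞ → Ω → Ω) : Prop where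
  shift : ∀ (s t : ℝ≥0) (ω : Ω), X s (Θ t ω) = X (s + t) ω
  dead : ∃ deadPath : Ω, lifetime X deadPath = 0 ∧ ∀ ω, Θ ∞ ω = deadPath

/-- The transition operator `T_t f x = 𝔼_x (f (X_t))` on real functions, with `f Δ = 0`. -/
noncomputable def transition {m : MeasurableSpace Ω} (X : ℝ≥0 → Ω → WithCemetery E)
    (P : E → Measure Ω) (t : ℝ≥0) (f : E → ℝ) (x : E) : ℝ :=
  ∫ ω, extendZero f (X t ω) ∂(P x)

/-- The transition operator on `[0, ∞]`-valued functions, with `f Δ = 0`. -/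
noncomputable def ltransition {m : MeasurableSpace Ω} (X : ℝ≥0 → Ω → WithCemetery E)
    (P : E → Measure Ω) (t : ℝ≥0) (f : E → ℝ≥0∞) (x : E) : ℝ≥0∞ :=
  ∫⁻ ω, extendZero f (X t ω) ∂(P x)

variable [TopologicalSpace E]

/-- `α`-excessive functions: universally measurable `f ≥ 0` such that `e^{-α t} T_t f ↑ f`
pointwise as `t ↓ 0`. -/
structure IsExcessive {m : MeasurableSpace Ω} (X : ℝ≥0 → Ω → WithCemetery E)
    (P : E → Measure Ω) (α : ℝ≥0) (f : E → ℝ≥0∞) : Prop where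
  measurable : Measurable[univBorel E] f
  antitone : ∀ x, AntitoneOn
    (fun t : ℝ≥0 => ENNReal.ofReal (Real.exp (-(α * t : ℝ))) * ltransition X P t f x) (Ioi 0)
  tendsto : ∀ x, Tendsto
    (fun t : ℝ≥0 => ENNReal.ofReal (Real.exp (-(α * t : ℝ))) * ltransition X P t f x)
    (𝓝[>] 0) (𝓝 (f x))

/-! ## Augmentation and natural filtrations -/

/-- The augmentation of a `σ`-algebra `𝓐` on `Ω` relative to the family `P`:
`⋂_μ (𝓐 ∨ 𝓝^μ)`, where `μ` runs over the finite initial laws and `𝓝^μ` consists of the null sets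
(in the ambient `σ`-algebra `m`) of `P^μ = ∫ P_x μ(dx)`. That is, `A ∈ m` belongs to it iff for
every `μ` there is `B ∈ 𝓐` with `P_x (A ∆ B) = 0` for `μ`-almost every `x`. -/
@[reducible]
def augment {m : MeasurableSpace Ω} (P : E → Measure Ω) (𝓐 : MeasurableSpace Ω) :
    MeasurableSpace Ω where
  MeasurableSet' A := MeasurableSet[m] A ∧
    ∀ μ : @Measure E (borel E), @IsFiniteMeasure E (borel E) μ →
      ∃ B, MeasurableSet[𝓐] B ∧ ∀ᵐ x ∂μ, P x (symmDiff A B) = 0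
  measurableSet_empty := ⟨@MeasurableSet.empty Ω m, fun μ _ =>
    ⟨∅, @MeasurableSet.empty Ω 𝓐, by simp⟩⟩
  measurableSet_compl := fun A hA => ⟨hA.1.compl, fun μ hμ => by
    obtain ⟨B, hB, h⟩ := hA.2 μ hμ
    exact ⟨Bᶜ, hB.compl, by simpa only [compl_symmDiff_compl] using h⟩⟩
  measurableSet_iUnion := fun A hA => ⟨MeasurableSet.iUnion fun i => (hA i).1, fun μ hμ => by
    choose B hB h using fun i => (hA i).2 μ hμ
    refine ⟨⋃ i, B i, MeasurableSet.iUnion hB, ?_⟩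
    filter_upwards [ae_all_iff.2 h] with x hx
    refine measure_mono_null (fun ω hω => ?_) (measure_iUnion_null hx)
    simp only [mem_symmDiff, mem_iUnion, not_exists] at hω ⊢
    rcases hω with ⟨⟨i, hi⟩, h'⟩ | ⟨⟨i, hi⟩, h'⟩
    · exact ⟨i, Or.inl ⟨hi, h' i⟩⟩
    · exact ⟨i, Or.inr ⟨hi, h' i⟩⟩⟩

/-- The raw `σ`-algebra `𝓕⁰_t = σ(X_s, s ≤ t)`, where the state space carries the universal
completion of its Borel `σ`-algebra. -/
@[reducible]
def rawNatural (X : ℝ≥0 → Ω → WithCemetery E) (t : ℝ≥0) : MeasurableSpace Ω :=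
  ⨆ (s : ℝ≥0) (_ : s ≤ t), (univBorel (WithCemetery E)).comap (X s)

/-- The natural filtration of `X`: the augmentation of `σ(X_s, s ≤ t)` relative to `P`. -/
def naturalFiltration {m : MeasurableSpace Ω} (P : E → Measure Ω)
    (X : ℝ≥0 → Ω → WithCemetery E) : Filtration ℝ≥0 m where
  seq t := augment P (rawNatural X t)
  mono' s t hst A hA := ⟨hA.1, fun μ hμ => by
    obtain ⟨B, hB, h⟩ := hA.2 μ hμ
    have hle : rawNatural X s ≤ rawNatural X t :=
      iSup₂_le fun r hr => le_iSup₂_of_le r (hr.trans hst) le_rfl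
    exact ⟨B, hle _ hB, h⟩⟩
  le' _ _ hA := hA.1

/-! ## Markov processes, right processes, terminal times -/

/-- `(Ω, m, 𝓖, X, Θ, P)` is a (normal, right continuous) Markov process with state space `E` and
cemetery `Δ`. -/
structure IsMarkovProcess {m : MeasurableSpace Ω} (𝓖 : Filtration ℝ≥0 m)
    (X : ℝ≥0 → Ω → WithCemetery E) (Θ : ℝ≥0∞ → Ω → Ω) (P : E → Measure Ω) : Prop where
  probability : ∀ x, IsProbabilityMeasure (P x)
  rightContinuous : ∀ ω t, ContinuousWithinAt (fun s => X s ω) (Ici t) t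
  adapted : ∀ t, Measurable[𝓖 t, univBorel (WithCemetery E)] (X t)
  shiftFamily : IsShiftFamily X Θ
  absorbing : ∀ ω (t : ℝ≥0), lifetime X ω ≤ t → X t ω = cemetery
  normal : ∀ x, ∀ᵐ ω ∂(P x), X 0 ω = Sum.inl x
  measurable_transition : ∀ (t : ℝ≥0) (B : Set E), MeasurableSet[univBorel E] B →
    Measurable[univBorel E] fun x => P x {ω | X t ω ∈ Sum.inl '' B}
  markov : ∀ (x : E) (s t : ℝ≥0) (f : E → ℝ), Measurable[univBorel E] f →
    (∃ C, ∀ y, |f y| ≤ C) →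
      (P x)[fun ω => extendZero f (X (s + t) ω) | 𝓖 s]
        =ᵐ[P x] fun ω => extendZero (transition X P t f) (X s ω)

/-- `(Ω, m, 𝓖, X, Θ, P)` is a right process with state space `E` and cemetery `Δ`: a Markov
process with an augmented and right continuous filtration such that for all `α > 0` and all
`α`-excessive `f`, the map `t ↦ f (X_t)` is a.s. right continuous. -/
structure IsRightProcess {m : MeasurableSpace Ω} (𝓖 : Filtration ℝ≥0 m)
    (X : ℝ≥0 → Ω → WithCemetery E) (Θ : ℝ≥0∞ → Ω → Ω) (P : E → Measure Ω) : Prop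
    extends IsMarkovProcess 𝓖 X Θ P where
  augmented : ∀ t, augment P (𝓖 t) = 𝓖 t
  filtration_rightContinuous : 𝓖.IsRightContinuous
  excessive_rightContinuous : ∀ α : ℝ≥0, 0 < α → ∀ f : E → ℝ≥0∞, IsExcessive X P α f →
    ∀ x, ∀ᵐ ω ∂(P x), ∀ t, ContinuousWithinAt (fun s => extendZero f (X s ω)) (Ici t) t

/-- A terminal time: a stopping time `T` with `t + T ∘ Θ_t = T` on `{t < T}`. -/
structure IsTerminalTime {m : MeasurableSpace Ω} (𝓖 : Filtration ℝ≥0 m)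
    (Θ : ℝ≥0∞ → Ω → Ω) (T : Ω → ℝ≥0∞) : Prop where
  isStoppingTime : IsStoppingTime 𝓖 T
  terminal : ∀ (t : ℝ≥0) (ω : Ω), (t : ℝ≥0∞) < T ω → (t : ℝ≥0∞) + T (Θ t ω) = T ω

end Definitions

end RightProc

namespace RightProc

universe u v

/-! Write `Z` for the process killed at `T = sup R n`, and `Zⁿ` for the one killed at `R n`. Since
functions vanish at `Δ`, `g (Zⁿ_t)` increases to `g (Z_t)` for every `g ≥ 0`
(`extendZero_kill_iSup`). Hence the transition operators of `Zⁿ` increase to those of `Z`, and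
statements phrased as integrals of nonnegative functions pass to the limit by monotone convergence.
A starting point `x` lies in `ER n` for all large `n`, so only the tail of the sequence matters for
`P x`. Measurability in `x` glues over the cover because a Radon subspace of a Hausdorff space is
universally measurable (`measurableSet_of_isRadonSpace`).

The Markov property is proved relative to the right limit `𝓕⁰_{s+}` of the raw filtration of `Z`.
The trace of such an event on `{s < R n}` belongs to the right continuous filtration of `Zⁿ`, and
off this set `Zⁿ` is already dead at time `s` (`setLIntegral_kill`). The strength gained by using
`𝓕⁰_{s+}` yields Blumenthal's law (`exists_rawNatural_symmDiff_eq_zero`), and with it right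
continuity of the augmented natural filtration.

An `α`-excessive `f` for `Z` restricts to an `α`-excessive function for `Zⁿ`: early killing only
lowers the operators, and as `R n > 0` a.s. nothing is lost as `t ↓ 0`
(`IsExcessive.restrict_kill`). So `f (Zⁿ)` is right continuous; `f (Z)` agrees with it before `R n`,
and is zero from `T` on. -/

/-! ### Universally measurable sets and Radon subspaces -/

theorem borel_le_univBorel (α : Type u) [TopologicalSpace α] : borel α ≤ univBorel α :=
  fun _ hs _ _ => MeasurableSet.nullMeasurableSet hs

theorem measurable_univBorel_of_continuous {α β : Type*} [TopologicalSpace α]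
    [TopologicalSpace β] {f : α → β} (hf : Continuous f) :
    Measurable[univBorel α, univBorel β] f := by
  intro s hs μ hμ
  let : MeasurableSpace α := borel α
  let : MeasurableSpace β := borel β
  have : BorelSpace α := ⟨rfl⟩
  have : BorelSpace β := ⟨rfl⟩
  have h : NullMeasurableSet s (μ.map f) := hs _ (Measure.isFiniteMeasure_map μ f)
  exact h.preimage (hf.measurable.quasiMeasurePreserving μ)

theorem exists_preimage_eq_of_isInducing {α β : Type*} [TopologicalSpace α] [MeasurableSpace α]
    [BorelSpace α] [TopologicalSpace β] [MeasurableSpace β] [BorelSpace β] {e : α → β}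
    (he : IsInducing e) {s : Set α} (hs : MeasurableSet s) :
    ∃ t, MeasurableSet t ∧ e ⁻¹' t = s := by
  rw [BorelSpace.measurable_eq (α := α), he.eq_induced, borel_comap] at hs
  obtain ⟨t, ht, rfl⟩ := hs
  exact ⟨t, (BorelSpace.measurable_eq (α := β)).symm ▸ ht, rfl⟩

/-- The trace of a Borel measure along an embedding whose range need not be measurable. -/
theorem exists_trace_measure {α β : Type*} [TopologicalSpace α] [MeasurableSpace α] [BorelSpace α]
    [TopologicalSpace β] [MeasurableSpace β] [BorelSpace β] {e : α → β} (he : IsEmbedding e)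
    (μ : Measure β) [IsFiniteMeasure μ] :
    ∃ ν : Measure α, IsFiniteMeasure ν ∧ ∀ s, MeasurableSet s → ν s = μ (e '' s) := by
  -- A Borel set of `α` is the trace of a Borel set `t` of `β`, and `t` splits every set additively
  -- for the outer measure of `μ`. This makes the pulled-back outer measure a measure on Borel sets.
  have hle : ‹MeasurableSpace α› ≤ (OuterMeasure.comap e μ.toOuterMeasure).caratheodory := by
    intro s hs
    obtain ⟨t, ht, rfl⟩ := exists_preimage_eq_of_isInducing he.isInducing hs
    refine (OuterMeasure.isCaratheodory_iff _).2 fun u => ?_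
    simp only [OuterMeasure.comap_apply]
    have h1 : e '' (u ∩ e ⁻¹' t) = e '' u ∩ t := image_inter_preimage e u t
    have h2 : e '' (u \ e ⁻¹' t) = e '' u \ t := image_sdiff_preimage
    rw [h1, h2]
    exact (measure_inter_add_sdiff (e '' u) ht).symm
  refine ⟨(OuterMeasure.comap e μ.toOuterMeasure).toMeasure hle, ⟨?_⟩, fun s hs => ?_⟩
  · rw [toMeasure_apply _ _ MeasurableSet.univ]
    exact measure_lt_top μ _
  · rw [toMeasure_apply _ _ hs]
    rfl

/-- For the trace `ν` of `μ`, `s` differs by a `ν`-null set from some `e ⁻¹' t'` with `t'` Borel.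
Hence `e '' s` differs by a `μ`-null set from `range e ∩ t'`, which is `μ`-measurable. -/
theorem measurableSet_image_of_isEmbedding {α β : Type*} [TopologicalSpace α]
    [TopologicalSpace β] {e : α → β} (he : IsEmbedding e)
    (hr : MeasurableSet[univBorel β] (range e)) {s : Set α} (hs : MeasurableSet[univBorel α] s) :
    MeasurableSet[univBorel β] (e '' s) := by
  intro μ hμ
  let : MeasurableSpace α := borel α
  let : MeasurableSpace β := borel β
  have : BorelSpace α := ⟨rfl⟩
  have : BorelSpace β := ⟨rfl⟩
  obtain ⟨ν, hν, hνe⟩ := exists_trace_measure he μ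
  obtain ⟨t, ht, hst⟩ := hs ν hν
  have hnull : μ (e '' (symmDiff s t)) = 0 := by
    have h0 : ν (symmDiff s t) = 0 := measure_symmDiff_eq_zero_iff.2 hst
    obtain ⟨N, hN, hNm, hN0⟩ := exists_measurable_superset_of_null h0
    exact measure_mono_null (image_mono hN) ((hνe N hNm).symm.trans hN0)
  obtain ⟨t', ht', rfl⟩ := exists_preimage_eq_of_isInducing he.isInducing ht
  have h1 : NullMeasurableSet (range e ∩ t') μ := (hr μ hμ).inter ht'.nullMeasurableSet
  refine h1.congr ?_
  refine (measure_symmDiff_eq_zero_iff.1 (measure_mono_null ?_ hnull)).symm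
  rintro y (⟨⟨x, hx, rfl⟩, hy⟩ | ⟨⟨⟨x, rfl⟩, hy⟩, hy'⟩)
  · exact ⟨x, Or.inl ⟨hx, fun h => hy ⟨⟨x, rfl⟩, h⟩⟩, rfl⟩
  · exact ⟨x, Or.inr ⟨hy, fun h => hy' ⟨x, h, rfl⟩⟩, rfl⟩

theorem IsRadonSpace.t2Space {E : Type u} [TopologicalSpace E] (h : IsRadonSpace E) :
    T2Space E := by
  obtain ⟨K, _, _, _, φ, hφ, _⟩ := h
  exact hφ.t2Space

/-- A finite Borel measure on a Radon space is carried by a `σ`-compact set. -/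
theorem IsRadonSpace.exists_compact_cover {E : Type u} [TopologicalSpace E] [MeasurableSpace E]
    [BorelSpace E] (h : IsRadonSpace E) (ν : Measure E) [IsFiniteMeasure ν] :
    ∃ L : ℕ → Set E, (∀ n, IsCompact (L n)) ∧ ν (⋃ n, L n)ᶜ = 0 := by
  obtain ⟨K, _, _, _, φ, hφ, hr⟩ := h
  let : MeasurableSpace K := borel K
  have : BorelSpace K := ⟨rfl⟩
  have hφm : Measurable φ := hφ.continuous.measurable
  have hr' : NullMeasurableSet (range φ) (ν.map φ) := hr _ (Measure.isFiniteMeasure_map ν φ)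
  obtain ⟨G, hGr, hGm, hG⟩ := hr'.exists_measurable_subset_ae_eq
  have hdiff : (ν.map φ) (range φ \ G) = 0 := (ae_le_set.1 hG.symm.le)
  -- The compact sets are taken inside `G ⊆ range φ`, so that their preimages under the embedding
  -- are again compact.
  have hcover : ∀ n : ℕ, ∃ C ⊆ G, IsCompact C ∧ (ν.map φ) (G \ C) < ((n : ℝ≥0∞) + 1)⁻¹ := by
    intro n
    let := TopologicalSpace.metrizableSpaceMetric K
    exact hGm.exists_isCompact_sdiff_lt (measure_ne_top _ _) (by simp)
  choose C hCG hCc hC using hcover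
  refine ⟨fun n => φ ⁻¹' C n, fun n => ?_, ?_⟩
  · rw [hφ.isInducing.isCompact_iff, image_preimage_eq_of_subset ((hCG n).trans hGr)]
    exact hCc n
  · have h1 : (ν.map φ) (G \ ⋃ n, C n) = 0 := by
      refine le_antisymm (ge_of_tendsto' (x := atTop) (f := fun n : ℕ => ((n : ℝ≥0∞) + 1)⁻¹) ?_
        fun n => (measure_mono (sdiff_subset_sdiff_right (subset_iUnion C n))).trans (hC n).le)
        zero_le
      have := (tendsto_add_atTop_iff_nat 1).2 ENNReal.tendsto_inv_nat_nhds_zero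
      simpa using this
    have h2 : (ν.map φ) ((range φ \ G) ∪ (G \ ⋃ n, C n)) = 0 := measure_union_null hdiff h1
    obtain ⟨N, hN, hNm, hN0⟩ := exists_measurable_superset_of_null h2
    rw [Measure.map_apply hφm hNm] at hN0
    refine measure_mono_null (fun x hx => hN ?_) hN0
    simp only [mem_compl_iff, mem_iUnion, mem_preimage, not_exists] at hx
    by_cases hG' : φ x ∈ G
    · exact Or.inr ⟨hG', by simpa using hx⟩
    · exact Or.inl ⟨⟨x, rfl⟩, hG'⟩

/-- The trace on `A` of a finite measure is carried by countably many compact subsets of `A`. These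
are closed in the Hausdorff space `E`, so `A` is an `F_σ` set up to a null set. -/
theorem measurableSet_of_isRadonSpace {E : Type u} [TopologicalSpace E] [T2Space E] {A : Set E}
    (hA : IsRadonSpace A) : MeasurableSet[univBorel E] A := by
  intro μ hμ
  let : MeasurableSpace E := borel E
  have : BorelSpace E := ⟨rfl⟩
  obtain ⟨ν, hν, hνe⟩ := exists_trace_measure (IsEmbedding.subtypeVal (p := (· ∈ A))) μ
  obtain ⟨L, hL, hL0⟩ := hA.exists_compact_cover ν
  have hLm : ∀ n, MeasurableSet (Subtype.val '' L n) := fun n =>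
    ((hL n).image continuous_subtype_val).measurableSet
  have hm : MeasurableSet (⋃ n, Subtype.val '' L n) := MeasurableSet.iUnion hLm
  have hLm' : MeasurableSet (⋃ n, L n) := by
    have : T2Space A := inferInstance
    exact MeasurableSet.iUnion fun n => (hL n).measurableSet
  rw [hνe _ hLm'.compl] at hL0
  refine hm.nullMeasurableSet.congr ?_
  refine (measure_symmDiff_eq_zero_iff.1 (measure_mono_null ?_ hL0)).symm
  rintro y (⟨hy, hy'⟩ | ⟨hy, hy'⟩)
  · refine ⟨⟨y, hy⟩, fun h => hy' ?_, rfl⟩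
    obtain ⟨n, hn⟩ := mem_iUnion.1 h
    exact mem_iUnion.2 ⟨n, _, hn, rfl⟩
  · obtain ⟨n, x, _, rfl⟩ := mem_iUnion.1 hy
    exact absurd x.2 hy'

/-- Transfers measurability from the intrinsic universal completions of the pieces to that of `E`.
-/
theorem measurable_of_cover_univBorel {E : Type u} {β : Type*} [TopologicalSpace E]
    [MeasurableSpace β] {A : ℕ → Set E} (hA : ∀ n, MeasurableSet[univBorel E] (A n))
    (hcover : ⋃ n, A n = univ) {f : E → β}
    (hf : ∀ n, Measurable[univBorel (A n)] fun x : A n => f x) : Measurable[univBorel E] f := by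
  intro s hs
  have h : f ⁻¹' s = ⋃ n, Subtype.val '' ((fun x : A n => f x) ⁻¹' s) := by
    ext x
    simp only [mem_preimage, mem_iUnion, mem_image, Subtype.exists, exists_and_right,
      exists_eq_right]
    refine ⟨fun hx => ?_, fun ⟨n, _, hx⟩ => hx⟩
    obtain ⟨n, hn⟩ := mem_iUnion.1 (hcover ▸ mem_univ x)
    exact ⟨n, hn, hx⟩
  rw [h]
  refine @MeasurableSet.iUnion _ _ (univBorel E) _ _ fun n => ?_
  refine measurableSet_image_of_isEmbedding IsEmbedding.subtypeVal ?_ (hf n hs)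
  rw [Subtype.range_val]
  exact hA n

theorem measurableSet_image_inl {E : Type u} [TopologicalSpace E] {s : Set E}
    (hs : MeasurableSet[univBorel E] s) :
    MeasurableSet[univBorel (WithCemetery E)] (Sum.inl '' s) := by
  refine measurableSet_image_of_isEmbedding IsEmbedding.inl
    (borel_le_univBorel _ _ ?_) hs
  exact MeasurableSpace.measurableSet_generateFrom isOpen_range_inl

theorem measurable_extendZero {E : Type u} {β : Type*} [TopologicalSpace E] [Zero β]
    [MeasurableSpace β] {f : E → β} (hf : Measurable[univBorel E] f) :
    Measurable[univBorel (WithCemetery E)] (extendZero f) := by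
  intro s hs
  have h1 : MeasurableSet[univBorel (WithCemetery E)] (Sum.inl '' (f ⁻¹' s)) :=
    measurableSet_image_inl (hf hs)
  have h2 : MeasurableSet[univBorel (WithCemetery E)] (range (Sum.inr : Unit → WithCemetery E)) :=
    borel_le_univBorel _ _ (MeasurableSpace.measurableSet_generateFrom isOpen_range_inr)
  by_cases h0 : (0 : β) ∈ s
  · have h : extendZero f ⁻¹' s = Sum.inl '' (f ⁻¹' s) ∪ range Sum.inr := by
      ext (x | x) <;> simp [extendZero, h0]
    rw [h]
    exact @MeasurableSet.union _ (univBorel _) _ _ h1 h2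
  · have h : extendZero f ⁻¹' s = Sum.inl '' (f ⁻¹' s) := by
      ext (x | x) <;> simp [extendZero, h0]
    rw [h]
    exact h1

/-! ### Transition operators and the Markov property for nonnegative functions -/

section Transition

variable {Ω : Type v} {E : Type u}

@[simp] theorem extendZero_inl {β : Type*} [Zero β] (f : E → β) (x : E) :
    extendZero f (Sum.inl x) = f x := rfl

@[simp] theorem extendZero_inr {β : Type*} [Zero β] (f : E → β) (x : Unit) :
    extendZero f (Sum.inr x) = 0 := rfl

@[simp] theorem extendZero_cemetery {β : Type*} [Zero β] (f : E → β) :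
    extendZero f cemetery = 0 := rfl

theorem extendZero_comp {β γ : Type*} [Zero β] [Zero γ] (φ : β → γ) (hφ : φ 0 = 0) (f : E → β)
    (y : WithCemetery E) : extendZero (fun x => φ (f x)) y = φ (extendZero f y) := by
  rcases y with y | y
  · rfl
  · exact hφ.symm

theorem extendZero_mono {f g : E → ℝ≥0∞} (h : f ≤ g) (y : WithCemetery E) :
    extendZero f y ≤ extendZero g y := by
  rcases y with y | y
  · exact h y
  · exact le_rfl

theorem extendZero_iSup {ι : Sort*} (f : ι → E → ℝ≥0∞) (y : WithCemetery E) :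
    extendZero (fun x => ⨆ i, f i x) y = ⨆ i, extendZero (f i) y := by
  rcases y with y | y <;> simp

variable {m : MeasurableSpace Ω} {X : ℝ≥0 → Ω → WithCemetery E} {P : E → Measure Ω}

theorem ltransition_mono (t : ℝ≥0) {f g : E → ℝ≥0∞} (h : f ≤ g) :
    ltransition X P t f ≤ ltransition X P t g :=
  fun _ => lintegral_mono fun _ => extendZero_mono h _

theorem ltransition_const_mul (t : ℝ≥0) {c : ℝ≥0∞} (hc : c ≠ ∞) (f : E → ℝ≥0∞) (x : E) :
    ltransition X P t (fun y => c * f y) x = c * ltransition X P t f x := by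
  unfold ltransition
  rw [← lintegral_const_mul' _ _ hc]
  exact lintegral_congr fun ω => extendZero_comp (c * ·) (mul_zero c) f _

theorem ltransition_le_of_le (hP : ∀ x, IsProbabilityMeasure (P x)) (t : ℝ≥0) {f : E → ℝ≥0∞}
    {c : ℝ≥0∞} (hf : ∀ y, f y ≤ c) (x : E) : ltransition X P t f x ≤ c := by
  calc ltransition X P t f x ≤ ∫⁻ _, c ∂(P x) := by
        refine lintegral_mono fun ω => ?_
        rcases X t ω with y | y
        · exact hf y
        · exact zero_le
    _ = c := by simp

variable [TopologicalSpace E]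

theorem measurable_extendZero_comp {𝓐 : MeasurableSpace Ω} {Y : Ω → WithCemetery E} {β : Type*}
    [Zero β] [MeasurableSpace β] (hY : Measurable[𝓐, univBorel (WithCemetery E)] Y) {f : E → β}
    (hf : Measurable[univBorel E] f) : Measurable[𝓐] fun ω => extendZero f (Y ω) :=
  (measurable_extendZero hf).comp hY

theorem ltransition_iSup {t : ℝ≥0} (hX : Measurable[m, univBorel (WithCemetery E)] (X t))
    {f : ℕ → E → ℝ≥0∞} (hf : ∀ n, Measurable[univBorel E] (f n)) (hmono : Monotone f) (x : E) :
    ltransition X P t (fun y => ⨆ n, f n y) x = ⨆ n, ltransition X P t (f n) x := by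
  unfold ltransition
  rw [← lintegral_iSup (fun n => measurable_extendZero_comp hX (hf n))
    fun i j hij ω => extendZero_mono (hmono hij) _]
  exact lintegral_congr fun ω => extendZero_iSup f _

theorem ltransition_indicator_const {t : ℝ≥0}
    (hX : Measurable[m, univBorel (WithCemetery E)] (X t)) (c : ℝ≥0∞) {s : Set E}
    (hs : MeasurableSet[univBorel E] s) (x : E) :
    ltransition X P t (s.indicator fun _ => c) x = c * P x {ω | X t ω ∈ Sum.inl '' s} := by
  have hm : MeasurableSet {ω | X t ω ∈ Sum.inl '' s} := hX (measurableSet_image_inl hs)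
  rw [← lintegral_indicator_const hm]
  refine lintegral_congr fun ω => ?_
  rcases hω : X t ω with y | y
  · by_cases hy : y ∈ s
    · rw [indicator_of_mem (show ω ∈ {ω | X t ω ∈ Sum.inl '' s} from ⟨y, hy, hω.symm⟩)]
      simp [hy]
    · rw [indicator_of_notMem (show ω ∉ {ω | X t ω ∈ Sum.inl '' s} by simp [hω, hy])]
      simp [hy]
  · simp [indicator, hω]

theorem measurable_ltransition {t : ℝ≥0} (hX : Measurable[m, univBorel (WithCemetery E)] (X t))
    (h : ∀ B : Set E, MeasurableSet[univBorel E] B →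
      Measurable[univBorel E] fun x => P x {ω | X t ω ∈ Sum.inl '' B})
    {f : E → ℝ≥0∞} (hf : Measurable[univBorel E] f) :
    Measurable[univBorel E] (ltransition X P t f) := by
  let _ : MeasurableSpace E := univBorel E
  refine Measurable.ennreal_induction (motive := fun f => Measurable (ltransition X P t f))
    (fun c s hs => ?_) (fun f g _ hf hg ihf ihg => ?_) (fun f hf hmono ih => ?_) hf
  · have : ltransition X P t (s.indicator fun _ => c) =
        fun x => c * P x {ω | X t ω ∈ Sum.inl '' s} :=
      funext fun x => ltransition_indicator_const hX c hs x
    rw [this]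
    exact (h s hs).const_mul c
  · have : ltransition X P t (f + g) =
        fun x => ltransition X P t f x + ltransition X P t g x := by
      funext x
      unfold ltransition
      rw [← lintegral_add_left (measurable_extendZero_comp hX hf)]
      refine lintegral_congr fun ω => ?_
      rcases X t ω with y | y <;> simp
    rw [this]
    exact ihf.add ihg
  · have : ltransition X P t (fun y => ⨆ n, f n y) = fun x => ⨆ n, ltransition X P t (f n) x :=
      funext fun x => ltransition_iSup hX hf hmono x
    rw [this]
    exact Measurable.iSup ih

theorem integrable_extendZero_comp {μ : Measure Ω} [IsFiniteMeasure μ] {Y : Ω → WithCemetery E}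
    (hY : Measurable[m, univBorel (WithCemetery E)] Y) {f : E → ℝ}
    (hf : Measurable[univBorel E] f) {C : ℝ} (hC : ∀ y, |f y| ≤ C) :
    Integrable (fun ω => extendZero f (Y ω)) μ := by
  refine Integrable.of_bound (measurable_extendZero_comp hY hf).aestronglyMeasurable (max C 0)
    (ae_of_all _ fun ω => ?_)
  rcases Y ω with y | y
  · exact (hC y).trans (le_max_left _ _)
  · simp

theorem iSup_ofReal_toReal_min (a : ℝ≥0∞) :
    ⨆ k : ℕ, ENNReal.ofReal (min a k).toReal = a := by
  have h : ∀ k : ℕ, ENNReal.ofReal (min a k).toReal = min a k := fun k =>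
    ENNReal.ofReal_toReal (ne_top_of_le_ne_top (ENNReal.natCast_ne_top k) (min_le_right _ _))
  simp only [h]
  rw [← inf_iSup_eq, ENNReal.iSup_natCast, inf_top_eq]

/-- Bounded nonnegative functions are handled by the defining property of conditional expectation; a
general `g` is the supremum of its truncations `min g k`. This integral form is the one that
survives monotone limits. -/
theorem IsMarkovProcess.setLIntegral {𝓖 : Filtration ℝ≥0 m} {Θ : ℝ≥0∞ → Ω → Ω}
    (h : IsMarkovProcess 𝓖 X Θ P) (x : E) (s t : ℝ≥0) {g : E → ℝ≥0∞}
    (hg : Measurable[univBorel E] g) {A : Set Ω} (hA : MeasurableSet[𝓖 s] A) :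
    ∫⁻ ω in A, extendZero g (X (s + t) ω) ∂(P x) =
      ∫⁻ ω in A, extendZero (ltransition X P t g) (X s ω) ∂(P x) := by
  have hP := h.probability
  have hX : ∀ t, Measurable[m, univBorel (WithCemetery E)] (X t) := fun t =>
    (h.adapted t).mono (𝓖.le t) le_rfl
  have key : ∀ (f : E → ℝ), Measurable[univBorel E] f → (∀ y, 0 ≤ f y) →
      ∀ C, (∀ y, |f y| ≤ C) → ∫⁻ ω in A, extendZero (fun y => ENNReal.ofReal (f y)) (X (s + t) ω)
        ∂(P x) = ∫⁻ ω in A, extendZero (ltransition X P t fun y => ENNReal.ofReal (f y)) (X s ω)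
        ∂(P x) := by
    intro f hf h0 C hC
    have h0' : ∀ y : WithCemetery E, 0 ≤ extendZero f y := by
      rintro (y | y)
      · exact h0 y
      · exact le_rfl
    have hm := h.markov x s t f hf ⟨C, hC⟩
    have hl : ∀ y, ltransition X P t (fun y => ENNReal.ofReal (f y)) y =
        ENNReal.ofReal (transition X P t f y) := by
      intro y
      unfold ltransition transition
      rw [ofReal_integral_eq_lintegral_ofReal (integrable_extendZero_comp (hX t) hf hC)
        (ae_of_all _ fun ω => h0' _)]
      exact lintegral_congr fun ω => extendZero_comp ENNReal.ofReal ENNReal.ofReal_zero f _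
    have hi := integrable_extendZero_comp (μ := P x) (hX (s + t)) hf hC
    have hset := setIntegral_condExp (𝓖.le s) hi hA
    have hi' : Integrable (fun ω => extendZero (transition X P t f) (X s ω)) (P x) :=
      (integrable_congr hm).1 integrable_condExp
    have h0'' : ∀ y : WithCemetery E, 0 ≤ extendZero (transition X P t f) y := by
      rintro (y | y)
      · exact integral_nonneg fun ω => h0' _
      · exact le_rfl
    rw [integral_congr_ae (ae_restrict_of_ae hm)] at hset
    rw [show (ltransition X P t fun y => ENNReal.ofReal (f y)) =
      fun y => ENNReal.ofReal (transition X P t f y) from funext hl]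
    have e1 : ∀ ω, extendZero (fun y => ENNReal.ofReal (f y)) (X (s + t) ω) =
        ENNReal.ofReal (extendZero f (X (s + t) ω)) := fun ω =>
      extendZero_comp ENNReal.ofReal ENNReal.ofReal_zero f _
    have e2 : ∀ ω, extendZero (fun y => ENNReal.ofReal (transition X P t f y)) (X s ω) =
        ENNReal.ofReal (extendZero (transition X P t f) (X s ω)) := fun ω =>
      extendZero_comp ENNReal.ofReal ENNReal.ofReal_zero _ _
    simp only [e1, e2]
    rw [← ofReal_integral_eq_lintegral_ofReal hi.integrableOn (ae_of_all _ fun ω => h0' _),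
      ← ofReal_integral_eq_lintegral_ofReal hi'.integrableOn (ae_of_all _ fun ω => h0'' _), hset]
  have hgk : ∀ k : ℕ, Measurable[univBorel E] fun y => (min (g y) k).toReal := fun k => by
    let _ : MeasurableSpace E := univBorel E
    exact (hg.min measurable_const).ennreal_toReal
  have hgk' : ∀ k : ℕ, Measurable[univBorel E] fun y => ENNReal.ofReal (min (g y) k).toReal :=
    fun k => by
      let _ : MeasurableSpace E := univBorel E
      exact (hgk k).ennreal_ofReal
  have hmono : Monotone fun (k : ℕ) y => ENNReal.ofReal (min (g y) k).toReal := by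
    intro i j hij y
    refine ENNReal.ofReal_le_ofReal (ENNReal.toReal_mono ?_ (min_le_min le_rfl (by simpa)))
    exact ne_top_of_le_ne_top (ENNReal.natCast_ne_top j) (min_le_right _ _)
  have hgs : g = fun y => ⨆ k : ℕ, ENNReal.ofReal (min (g y) k).toReal :=
    funext fun y => (iSup_ofReal_toReal_min (g y)).symm
  have hts : ltransition X P t g =
      fun y => ⨆ k : ℕ, ltransition X P t (fun y => ENNReal.ofReal (min (g y) k).toReal) y := by
    funext y
    conv_lhs => rw [hgs]
    exact ltransition_iSup (hX t) hgk' hmono y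
  rw [hts]
  conv_lhs => rw [hgs]
  simp only [extendZero_iSup]
  rw [lintegral_iSup (fun k => measurable_extendZero_comp (hX _) (hgk' k))
      fun i j hij ω => extendZero_mono (hmono hij) _,
    lintegral_iSup (fun k => measurable_extendZero_comp (hX _)
      (measurable_ltransition (hX t) (h.measurable_transition t) (hgk' k)))
      fun i j hij ω => extendZero_mono (ltransition_mono t (hmono hij)) _]
  refine iSup_congr fun k => key _ (hgk k) (fun y => ENNReal.toReal_nonneg) k fun y => ?_
  rw [abs_of_nonneg ENNReal.toReal_nonneg]
  exact ENNReal.toReal_le_of_le_ofReal (Nat.cast_nonneg k) (by simp)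

theorem IsMarkovProcess.ltransition_add {𝓖 : Filtration ℝ≥0 m} {Θ : ℝ≥0∞ → Ω → Ω}
    (h : IsMarkovProcess 𝓖 X Θ P) (s t : ℝ≥0) {g : E → ℝ≥0∞}
    (hg : Measurable[univBorel E] g) (x : E) :
    ltransition X P (s + t) g x = ltransition X P s (ltransition X P t g) x := by
  have := h.setLIntegral x s t hg MeasurableSet.univ
  rwa [Measure.restrict_univ] at this

/-- By the semigroup property, passing from `s` to `s + r` applies the monotone operator `e^{-αs}
T_s` to `e^{-αr} T_r g ≤ g`. -/
theorem IsMarkovProcess.antitone_of_supermedian {𝓖 : Filtration ℝ≥0 m} {Θ : ℝ≥0∞ → Ω → Ω}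
    (h : IsMarkovProcess 𝓖 X Θ P) {α : ℝ≥0} {g : E → ℝ≥0∞} (hg : Measurable[univBorel E] g)
    (hsup : ∀ t : ℝ≥0, 0 < t → ∀ x,
      ENNReal.ofReal (Real.exp (-(α * t : ℝ))) * ltransition X P t g x ≤ g x) (x : E) :
    AntitoneOn (fun t : ℝ≥0 => ENNReal.ofReal (Real.exp (-(α * t : ℝ))) * ltransition X P t g x)
      (Ioi 0) := by
  intro s _ t _ hst
  rcases hst.eq_or_lt with rfl | hlt
  · exact le_rfl
  obtain ⟨r, hr, rfl⟩ := exists_pos_add_of_lt' hlt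
  have he : ENNReal.ofReal (Real.exp (-(α * (s + r : ℝ≥0) : ℝ))) =
      ENNReal.ofReal (Real.exp (-(α * s : ℝ))) * ENNReal.ofReal (Real.exp (-(α * r : ℝ))) := by
    rw [← ENNReal.ofReal_mul (Real.exp_nonneg _), ← Real.exp_add]
    congr 2
    push_cast
    ring
  simp only
  rw [he, h.ltransition_add s r hg x, mul_assoc,
    ← ltransition_const_mul s ENNReal.ofReal_ne_top]
  exact mul_le_mul_right (ltransition_mono s (fun y => hsup r hr y) x) _

theorem transition_eq_sub {t : ℝ≥0} (hX : Measurable[m, univBorel (WithCemetery E)] (X t))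
    (hP : ∀ x, IsProbabilityMeasure (P x)) {f : E → ℝ} (hf : Measurable[univBorel E] f) {C : ℝ}
    (hC : ∀ y, |f y| ≤ C) (x : E) :
    transition X P t f x = (ltransition X P t (fun y => ENNReal.ofReal (f y)) x).toReal -
      (ltransition X P t (fun y => ENNReal.ofReal (-f y)) x).toReal := by
  unfold transition ltransition
  rw [integral_eq_lintegral_pos_part_sub_lintegral_neg_part
    (integrable_extendZero_comp hX hf hC)]
  congr 2
  · exact lintegral_congr fun ω =>
      (extendZero_comp ENNReal.ofReal ENNReal.ofReal_zero f _).symm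
  · exact lintegral_congr fun ω =>
      (extendZero_comp (fun a => ENNReal.ofReal (-a)) (by simp) f _).symm

/-- The way back from the integral form to conditional expectations: apply it to the positive and
negative parts of `f`, both of which have bounded transforms. -/
theorem condExp_of_setLIntegral {𝓐 : MeasurableSpace Ω} (h𝓐 : 𝓐 ≤ m)
    (hX : ∀ t, Measurable[m, univBorel (WithCemetery E)] (X t))
    (hP : ∀ x, IsProbabilityMeasure (P x)) {x : E} {s t : ℝ≥0}
    (hs : Measurable[𝓐, univBorel (WithCemetery E)] (X s))
    (htr : ∀ g : E → ℝ≥0∞, Measurable[univBorel E] g →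
      Measurable[univBorel E] (ltransition X P t g))
    (h : ∀ g : E → ℝ≥0∞, Measurable[univBorel E] g → ∀ A, MeasurableSet[𝓐] A →
      ∫⁻ ω in A, extendZero g (X (s + t) ω) ∂(P x) =
      ∫⁻ ω in A, extendZero (ltransition X P t g) (X s ω) ∂(P x))
    {f : E → ℝ} (hf : Measurable[univBorel E] f) {C : ℝ} (hC : ∀ y, |f y| ≤ C) :
    (P x)[fun ω => extendZero f (X (s + t) ω) | 𝓐]
        =ᵐ[P x] fun ω => extendZero (transition X P t f) (X s ω) := by
  have hp : Measurable[univBorel E] fun y => ENNReal.ofReal (f y) :=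
    ENNReal.measurable_ofReal.comp hf
  have hn : Measurable[univBorel E] fun y => ENNReal.ofReal (-f y) :=
    ENNReal.measurable_ofReal.comp (measurable_neg.comp hf)
  have hbp : ∀ y, ltransition X P t (fun y => ENNReal.ofReal (f y)) y ≤ ENNReal.ofReal C :=
    ltransition_le_of_le hP t fun y => ENNReal.ofReal_le_ofReal ((le_abs_self _).trans (hC y))
  have hbn : ∀ y, ltransition X P t (fun y => ENNReal.ofReal (-f y)) y ≤ ENNReal.ofReal C :=
    ltransition_le_of_le hP t fun y => ENNReal.ofReal_le_ofReal ((neg_le_abs _).trans (hC y))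
  set u : E → ℝ≥0∞ := ltransition X P t fun y => ENNReal.ofReal (f y) with hu
  set v : E → ℝ≥0∞ := ltransition X P t fun y => ENNReal.ofReal (-f y) with hv
  have hum := htr _ hp
  have hvm := htr _ hn
  have heq : ∀ ω, extendZero (transition X P t f) (X s ω) =
      (extendZero u (X s ω)).toReal - (extendZero v (X s ω)).toReal := by
    intro ω
    rcases X s ω with y | y
    · exact transition_eq_sub (hX t) hP hf hC y
    · simp
  have hbp' : ∀ ω, extendZero u (X s ω) < ∞ := by
    intro ω
    rcases X s ω with y | y
    · exact (hbp y).trans_lt ENNReal.ofReal_lt_top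
    · simp
  have hbn' : ∀ ω, extendZero v (X s ω) < ∞ := by
    intro ω
    rcases X s ω with y | y
    · exact (hbn y).trans_lt ENNReal.ofReal_lt_top
    · simp
  have hiu : Integrable (fun ω => (extendZero u (X s ω)).toReal) (P x) := by
    refine integrable_toReal_of_lintegral_ne_top
      (measurable_extendZero_comp (hX s) hum).aemeasurable
      (ne_top_of_le_ne_top ENNReal.ofReal_ne_top (ltransition_le_of_le hP s hbp x))
  have hiv : Integrable (fun ω => (extendZero v (X s ω)).toReal) (P x) := by
    refine integrable_toReal_of_lintegral_ne_top
      (measurable_extendZero_comp (hX s) hvm).aemeasurable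
      (ne_top_of_le_ne_top ENNReal.ofReal_ne_top (ltransition_le_of_le hP s hbn x))
  have hi := integrable_extendZero_comp (μ := P x) (hX (s + t)) hf hC
  have hfun : (fun ω => extendZero (transition X P t f) (X s ω)) =
      fun ω => (extendZero u (X s ω)).toReal - (extendZero v (X s ω)).toReal := funext heq
  rw [hfun]
  refine (ae_eq_condExp_of_forall_setIntegral_eq h𝓐 hi (fun A _ _ => (hiu.sub hiv).integrableOn)
    (fun A hA _ => ?_) ?_).symm
  · simp only [Pi.sub_apply]
    rw [integral_sub hiu.integrableOn hiv.integrableOn,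
      integral_eq_lintegral_pos_part_sub_lintegral_neg_part hi.integrableOn,
      integral_toReal (measurable_extendZero_comp (hX s) hum).aemeasurable (ae_of_all _ hbp'),
      integral_toReal (measurable_extendZero_comp (hX s) hvm).aemeasurable (ae_of_all _ hbn'),
      ← h _ hp A hA, ← h _ hn A hA]
    congr 2
    · exact lintegral_congr fun ω => extendZero_comp ENNReal.ofReal ENNReal.ofReal_zero f _
    · exact lintegral_congr fun ω =>
        extendZero_comp (fun a => ENNReal.ofReal (-a)) (by simp) f _
  · refine Measurable.aestronglyMeasurable (m := 𝓐) ?_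
    exact (measurable_extendZero_comp hs hum).ennreal_toReal.sub
      (measurable_extendZero_comp hs hvm).ennreal_toReal

end Transition

/-! ### Raw and augmented natural filtrations, Blumenthal's law -/

section NaturalFiltration

variable {Ω : Type v} {E : Type u}

theorem measurable_indicator_one {α : Type*} {𝓐 : MeasurableSpace α} {s : Set α}
    (hs : MeasurableSet s) : Measurable (s.indicator (1 : α → ℝ≥0∞)) :=
  measurable_one.indicator hs

theorem ae_le_of_forall_setLIntegral_le_trim {𝓐 m : MeasurableSpace Ω} (h𝓐 : 𝓐 ≤ m)
    {μ : Measure Ω} [IsFiniteMeasure μ] {f g : Ω → ℝ≥0∞} (hf : Measurable[𝓐] f)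
    (hg : Measurable[𝓐] g)
    (h : ∀ A, MeasurableSet[𝓐] A → ∫⁻ ω in A, f ω ∂μ ≤ ∫⁻ ω in A, g ω ∂μ) : f ≤ᵐ[μ] g := by
  refine ae_le_of_ae_le_trim (hm := h𝓐) ?_
  refine @ae_le_of_forall_setLIntegral_le_of_sigmaFinite Ω 𝓐 (μ.trim h𝓐) _ f g hf
    fun A hA _ => ?_
  rw [restrict_trim h𝓐 μ hA, lintegral_trim h𝓐 hf, lintegral_trim h𝓐 hg]
  exact h A hA

theorem lintegral_mul_eq_of_forall_setLIntegral_eq {𝓐 m : MeasurableSpace Ω} (h𝓐 : 𝓐 ≤ m)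
    {μ : Measure Ω} {F G : Ω → ℝ≥0∞} (hF : Measurable F) (hG : Measurable G)
    (h : ∀ A, MeasurableSet[𝓐] A → ∫⁻ ω in A, F ω ∂μ = ∫⁻ ω in A, G ω ∂μ)
    {W : Ω → ℝ≥0∞} (hW : Measurable[𝓐] W) :
    ∫⁻ ω, W ω * F ω ∂μ = ∫⁻ ω, W ω * G ω ∂μ := by
  refine @Measurable.ennreal_induction Ω 𝓐
    (fun W => ∫⁻ ω, W ω * F ω ∂μ = ∫⁻ ω, W ω * G ω ∂μ) (fun c s hs => ?_)
    (fun f g _ hf hg ihf ihg => ?_) (fun f hf hmono ih => ?_) W hW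
  · have key : ∀ H : Ω → ℝ≥0∞, Measurable H →
        ∫⁻ ω, s.indicator (fun _ => c) ω * H ω ∂μ = c * ∫⁻ ω in s, H ω ∂μ := by
      intro H hH
      rw [← lintegral_const_mul c hH, ← lintegral_indicator (h𝓐 _ hs)]
      refine lintegral_congr fun ω => ?_
      by_cases hω : ω ∈ s <;> simp [hω]
    rw [key F hF, key G hG, h s hs]
  · have hfm : ∀ H : Ω → ℝ≥0∞, Measurable H → Measurable fun ω => f ω * H ω := fun H hH =>
      (hf.mono h𝓐 le_rfl).mul hH
    simp only [Pi.add_apply, add_mul]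
    rw [lintegral_add_left (hfm F hF), lintegral_add_left (hfm G hG), ihf, ihg]
  · have hfm : ∀ H : Ω → ℝ≥0∞, Measurable H → ∀ n, Measurable fun ω => f n ω * H ω :=
      fun H hH n => ((hf n).mono h𝓐 le_rfl).mul hH
    have hfmono : ∀ H : Ω → ℝ≥0∞, Monotone fun n ω => f n ω * H ω :=
      fun H i j hij ω => mul_le_mul_left (hmono hij ω) _
    simp only [ENNReal.iSup_mul]
    rw [lintegral_iSup (hfm F hF) (hfmono F), lintegral_iSup (hfm G hG) (hfmono G)]
    exact iSup_congr ih

variable [TopologicalSpace E]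

/-- The right limit `𝓕⁰_{t+} = ⋂_{r > t} 𝓕⁰_r` of the raw filtration. -/
@[reducible]
def rawNaturalRight (X : ℝ≥0 → Ω → WithCemetery E) (t : ℝ≥0) : MeasurableSpace Ω :=
  ⨅ (r : ℝ≥0) (_ : t < r), rawNatural X r

theorem rawNatural_mono (X : ℝ≥0 → Ω → WithCemetery E) : Monotone (rawNatural X) :=
  fun _ _ h => iSup₂_le fun r hr => le_iSup₂_of_le r (hr.trans h) le_rfl

theorem rawNatural_le_rawNaturalRight (X : ℝ≥0 → Ω → WithCemetery E) (t : ℝ≥0) :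
    rawNatural X t ≤ rawNaturalRight X t :=
  le_iInf₂ fun _ hr => rawNatural_mono X hr.le

theorem rawNaturalRight_mono (X : ℝ≥0 → Ω → WithCemetery E) : Monotone (rawNaturalRight X) :=
  fun _ _ h => le_iInf₂ fun r hr => iInf₂_le r (h.trans_lt hr)

theorem measurable_rawNatural (X : ℝ≥0 → Ω → WithCemetery E) {s t : ℝ≥0} (h : s ≤ t) :
    Measurable[rawNatural X t, univBorel (WithCemetery E)] (X s) :=
  measurable_iff_comap_le.2 (le_iSup₂_of_le (f := fun (s : ℝ≥0) (_ : s ≤ t) =>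
    (univBorel (WithCemetery E)).comap (X s)) s h le_rfl)

variable {m : MeasurableSpace Ω} {X : ℝ≥0 → Ω → WithCemetery E} {P : E → Measure Ω}

theorem rawNatural_le (hX : ∀ t, Measurable[m, univBorel (WithCemetery E)] (X t)) (t : ℝ≥0) :
    rawNatural X t ≤ m :=
  iSup₂_le fun s _ => (hX s).comap_le

theorem rawNaturalRight_le (hX : ∀ t, Measurable[m, univBorel (WithCemetery E)] (X t))
    (t : ℝ≥0) : rawNaturalRight X t ≤ m :=
  iInf₂_le_of_le (t + 1) (lt_add_one t) (rawNatural_le hX _)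

/-- The events that at time `s` the process is alive and in a given set. -/
def aliveEvents (X : ℝ≥0 → Ω → WithCemetery E) (s : ℝ≥0) : Set (Set Ω) :=
  {A | ∃ B : Set E, MeasurableSet[univBorel E] B ∧ X s ⁻¹' (Sum.inl '' B) = A}

theorem isPiSystem_aliveEvents (X : ℝ≥0 → Ω → WithCemetery E) (s : ℝ≥0) :
    IsPiSystem (aliveEvents X s) := by
  rintro _ ⟨B, hB, rfl⟩ _ ⟨C, hC, rfl⟩ _
  refine ⟨B ∩ C, @MeasurableSet.inter _ (univBorel E) _ _ hB hC, ?_⟩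
  rw [image_inter Sum.inl_injective, preimage_inter]

/-- Death at time `s` is the complement of the alive event with `B = E`. Thus the generating
`π`-system needs only events whose indicators are products of functions vanishing at `Δ`. -/
theorem rawNatural_eq_generateFrom (X : ℝ≥0 → Ω → WithCemetery E) (t : ℝ≥0) :
    rawNatural X t = MeasurableSpace.generateFrom (piiUnionInter (aliveEvents X) (Iic t)) := by
  refine le_antisymm (iSup₂_le fun s hs => ?_) (MeasurableSpace.generateFrom_le ?_)
  · have hgen : ∀ B : Set E, MeasurableSet[univBorel E] B →
        MeasurableSet[MeasurableSpace.generateFrom (piiUnionInter (aliveEvents X) (Iic t))]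
          (X s ⁻¹' (Sum.inl '' B)) := fun B hB =>
      MeasurableSpace.measurableSet_generateFrom (subset_piiUnionInter (π := aliveEvents X) (S := Iic t) hs
        ⟨B, hB, rfl⟩)
    rintro _ ⟨D, hD, rfl⟩
    have hD' : MeasurableSet[univBorel E] ((Sum.inl : E → WithCemetery E) ⁻¹' D) :=
      measurable_univBorel_of_continuous continuous_inl hD
    by_cases h : cemetery ∈ D
    · have : X s ⁻¹' D = X s ⁻¹' (Sum.inl '' (Sum.inl ⁻¹' D)) ∪
          (X s ⁻¹' (Sum.inl '' univ))ᶜ := by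
        ext ω
        simp only [mem_preimage, mem_union, mem_compl_iff]
        rcases X s ω with y | ⟨⟩
        · simp
        · simpa [cemetery] using h
      rw [this]
      exact MeasurableSet.union (hgen _ hD')
        (hgen _ (@MeasurableSet.univ _ (univBorel E))).compl
    · have : X s ⁻¹' D = X s ⁻¹' (Sum.inl '' (Sum.inl ⁻¹' D)) := by
        ext ω
        simp only [mem_preimage]
        rcases X s ω with y | ⟨⟩
        · simp
        · simpa [cemetery] using h
      rw [this]
      exact hgen _ hD'
  · rintro _ ⟨S, hS, f, hf, rfl⟩
    refine Finset.measurableSet_biInter _ fun s hs => ?_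
    obtain ⟨B, hB, h⟩ := hf s hs
    rw [← h]
    exact measurable_rawNatural X (hS hs) (measurableSet_image_inl hB)

/-- Induction on the largest time `a`. If `a > t`, conditioning at `b`, the larger of `t` and the
remaining times, replaces `f a (X a)` by `T_{a-b} (f a) (X b)`. Since the transition operators do
not depend on the starting point, one `h` serves all `P x`. -/
theorem exists_rawNatural_prod (hX : ∀ t, Measurable[m, univBorel (WithCemetery E)] (X t))
    (htr : ∀ t, ∀ g : E → ℝ≥0∞, Measurable[univBorel E] g →
      Measurable[univBorel E] (ltransition X P t g))
    (hmk : ∀ (x : E) (s t : ℝ≥0) (g : E → ℝ≥0∞), Measurable[univBorel E] g →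
      ∀ A, MeasurableSet[rawNaturalRight X s] A →
        ∫⁻ ω in A, extendZero g (X (s + t) ω) ∂(P x) =
        ∫⁻ ω in A, extendZero (ltransition X P t g) (X s ω) ∂(P x)) (t : ℝ≥0)
    {w : Ω → ℝ≥0∞} (hw : Measurable[rawNatural X t] w) (S : Finset ℝ≥0) :
    ∀ f : ℝ≥0 → E → ℝ≥0∞, (∀ s, Measurable[univBorel E] (f s)) →
      ∃ h, Measurable[rawNatural X t] h ∧ ∀ x A, MeasurableSet[rawNaturalRight X t] A →
        ∫⁻ ω in A, w ω * ∏ s ∈ S, extendZero (f s) (X s ω) ∂(P x) = ∫⁻ ω in A, h ω ∂(P x) := by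
  have hprod : ∀ (S : Finset ℝ≥0) (b : ℝ≥0), (∀ s ∈ S, s ≤ b) → ∀ f : ℝ≥0 → E → ℝ≥0∞,
      (∀ s, Measurable[univBorel E] (f s)) →
      Measurable[rawNatural X b] fun ω => ∏ s ∈ S, extendZero (f s) (X s ω) := by
    intro S b hS f hf
    exact Finset.measurable_prod _ fun s hs =>
      measurable_extendZero_comp (measurable_rawNatural X (hS s hs)) (hf s)
  induction S using Finset.induction_on_max with
  | empty => exact fun f _ => ⟨w, hw, fun x A _ => by simp⟩
  | insert a S hmax ih =>
    intro f hf
    have ha : a ∉ S := fun h => (hmax a h).false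
    by_cases hat : a ≤ t
    · refine ⟨_, hw.mul (hprod (insert a S) t (fun s hs => ?_) f hf), fun x A _ => rfl⟩
      rcases Finset.mem_insert.1 hs with rfl | hs
      · exact hat
      · exact (hmax s hs).le.trans hat
    push Not at hat
    have step : ∀ b, t ≤ b → b < a → (∀ s ∈ S, s ≤ b) → ∀ x A,
        MeasurableSet[rawNaturalRight X t] A →
        ∫⁻ ω in A, w ω * ∏ s ∈ insert a S, extendZero (f s) (X s ω) ∂(P x) =
        ∫⁻ ω in A, (w ω * ∏ s ∈ S, extendZero (f s) (X s ω)) *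
          extendZero (ltransition X P (a - b) (f a)) (X b ω) ∂(P x) := by
      intro b htb hba hSb x A hA
      have hW : Measurable[rawNaturalRight X b]
          fun ω => w ω * ∏ s ∈ S, extendZero (f s) (X s ω) :=
        ((hw.mono (rawNatural_mono X htb) le_rfl).mul (hprod S b hSb f hf)).mono
          (rawNatural_le_rawNaturalRight X b) le_rfl
      have hle := rawNaturalRight_le hX b
      have hA' : MeasurableSet[rawNaturalRight X b] A := rawNaturalRight_mono X htb _ hA
      rw [← lintegral_mul_eq_of_forall_setLIntegral_eq hle
        (μ := (P x).restrict A) (F := fun ω => extendZero (f a) (X a ω))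
        (measurable_extendZero_comp (hX a) (hf a))
        (measurable_extendZero_comp (hX b) (htr _ _ (hf a))) ?_ hW]
      · refine lintegral_congr fun ω => ?_
        rw [Finset.prod_insert ha, mul_assoc, mul_comm (extendZero (f a) (X a ω))]
      · intro A' hA''
        have h := hmk x b (a - b) (f a) (hf a) (A' ∩ A)
          (@MeasurableSet.inter _ (rawNaturalRight X b) _ _ hA'' hA')
        rw [add_tsub_cancel_of_le hba.le] at h
        rwa [Measure.restrict_restrict (hle _ hA'')]
    by_cases hSt : ∀ s ∈ S, s ≤ t
    · exact ⟨_, (hw.mul (hprod S t hSt f hf)).mul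
        (measurable_extendZero_comp (measurable_rawNatural X le_rfl) (htr (a - t) _ (hf a))),
        step t le_rfl hat hSt⟩
    · push Not at hSt
      obtain ⟨s₀, hs₀, hts₀⟩ := hSt
      set b := S.max' ⟨s₀, hs₀⟩ with hb
      have hbS : b ∈ S := Finset.max'_mem _ _
      have hSb : ∀ s ∈ S, s ≤ b := fun s hs => Finset.le_max' _ _ hs
      -- The factor produced by conditioning at `b` is absorbed into the one already present at time
      -- `b`.
      obtain ⟨h, hh, hint⟩ := ih
        (fun s => if s = b then fun y => f s y * ltransition X P (a - b) (f a) y else f s)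
        (fun s => by
          split_ifs
          · exact (hf s).mul (htr _ _ (hf a))
          · exact hf s)
      refine ⟨h, hh, fun x A hA => ?_⟩
      rw [step b (hts₀.le.trans (hSb _ hs₀)) (hmax b hbS) hSb x A hA, ← hint x A hA]
      refine lintegral_congr fun ω => ?_
      rw [mul_assoc]
      congr 1
      have : ∀ s ∈ S, extendZero (if s = b then
          fun y => f s y * ltransition X P (a - b) (f a) y else f s) (X s ω) =
          extendZero (f s) (X s ω) *
            if s = b then extendZero (ltransition X P (a - b) (f a)) (X b ω) else 1 := by
        intro s _
        split_ifs with hsb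
        · rw [hsb]
          rcases X b ω with y | y <;> simp
        · simp
      rw [Finset.prod_congr rfl this, Finset.prod_mul_distrib, Finset.prod_ite_eq' S b,
        if_pos hbS]

/-- A `π`-`λ` argument from the finite products: the conditional probability of `C` given `𝓕⁰_{t+}`
has a version measurable for `𝓕⁰_t`, common to all `P x`. -/
theorem exists_rawNatural_condProb (hP : ∀ x, IsProbabilityMeasure (P x))
    (hX : ∀ t, Measurable[m, univBorel (WithCemetery E)] (X t))
    (htr : ∀ t, ∀ g : E → ℝ≥0∞, Measurable[univBorel E] g →
      Measurable[univBorel E] (ltransition X P t g))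
    (hmk : ∀ (x : E) (s t : ℝ≥0) (g : E → ℝ≥0∞), Measurable[univBorel E] g →
      ∀ A, MeasurableSet[rawNaturalRight X s] A →
        ∫⁻ ω in A, extendZero g (X (s + t) ω) ∂(P x) =
        ∫⁻ ω in A, extendZero (ltransition X P t g) (X s ω) ∂(P x)) (t r : ℝ≥0)
    {C : Set Ω} (hC : MeasurableSet[rawNatural X r] C) :
    ∃ h : Ω → ℝ≥0∞, Measurable[rawNatural X t] h ∧
      ∀ x A, MeasurableSet[rawNaturalRight X t] A → P x (C ∩ A) = ∫⁻ ω in A, h ω ∂(P x) := by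
  refine MeasurableSpace.induction_on_inter (m := rawNatural X r) (C := fun C _ => ∃ h : Ω → ℝ≥0∞,
      Measurable[rawNatural X t] h ∧ ∀ x A, MeasurableSet[rawNaturalRight X t] A →
      P x (C ∩ A) = ∫⁻ ω in A, h ω ∂(P x)) (rawNatural_eq_generateFrom X r)
    (isPiSystem_piiUnionInter _ (isPiSystem_aliveEvents X) _) ?_ ?_ ?_ ?_ C hC
  · exact ⟨0, measurable_const, fun x A _ => by simp⟩
  · rintro _ ⟨S, hS, F, hF, rfl⟩
    choose! B hB hBF using hF
    obtain ⟨h, hh, hint⟩ := exists_rawNatural_prod hX htr hmk t (w := 1) measurable_const S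
      (fun s => if s ∈ S then (B s).indicator 1 else 0) (fun s => by
        split_ifs with hs
        · exact measurable_indicator_one (𝓐 := univBorel E) (hB s hs)
        · exact measurable_const)
    refine ⟨h, hh, fun x A hA => ?_⟩
    have hmeas : MeasurableSet[m] (⋂ s ∈ S, F s) :=
      Finset.measurableSet_biInter _ fun s hs => by
        rw [← hBF s hs]
        exact hX s (measurableSet_image_inl (hB s hs))
    rw [← hint x A hA, ← Measure.restrict_apply hmeas, ← lintegral_indicator_one hmeas]
    refine lintegral_congr fun ω => ?_
    rw [Pi.one_apply, one_mul]
    have key : ∀ s ∈ S, extendZero (if s ∈ S then (B s).indicator (1 : E → ℝ≥0∞) else 0) (X s ω) =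
        (F s).indicator 1 ω := by
      intro s hs
      rw [if_pos hs]
      by_cases hω : ω ∈ F s
      · rw [indicator_of_mem hω]
        rw [← hBF s hs] at hω
        obtain ⟨y, hy, hyω⟩ := hω
        simp [← hyω, hy]
      · rw [indicator_of_notMem hω]
        rw [← hBF s hs] at hω
        rcases hyω : X s ω with y | y
        · have : y ∉ B s := fun hy => hω ⟨y, hy, hyω.symm⟩
          simp [this]
        · rfl
    rw [Finset.prod_congr rfl key]
    by_cases hω : ω ∈ ⋂ s ∈ S, F s
    · rw [indicator_of_mem hω]
      simp only [mem_iInter] at hω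
      exact (Finset.prod_eq_one fun s hs => indicator_of_mem (hω s hs) _).symm
    · rw [indicator_of_notMem hω]
      simp only [mem_iInter, not_forall] at hω
      obtain ⟨s, hs, hω⟩ := hω
      exact (Finset.prod_eq_zero hs (indicator_of_notMem hω _)).symm
  · rintro C hC ⟨h, hh, hint⟩
    have hCm := rawNatural_le hX r _ hC
    have hhm := hh.mono (rawNatural_le hX t) le_rfl
    refine ⟨fun ω => 1 - h ω, measurable_const.sub hh, fun x A hA => ?_⟩
    -- Subtraction in `ℝ≥0∞` is truncated, so `1 - h` is the complementary probability only where `h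
    -- ≤ 1`.
    have hle : h ≤ᵐ[P x] fun _ => 1 := by
      refine ae_le_of_forall_setLIntegral_le_trim (rawNatural_le hX t) hh measurable_const
        fun A hA => ?_
      rw [← hint x A (rawNatural_le_rawNaturalRight X t _ hA), setLIntegral_const, one_mul]
      exact measure_mono inter_subset_right
    have hfin : ∫⁻ ω in A, h ω ∂(P x) ≠ ∞ := by
      rw [← hint x A hA]
      exact measure_ne_top _ _
    rw [lintegral_sub hhm hfin (ae_restrict_of_ae hle), ← hint x A hA, setLIntegral_const,
      one_mul, inter_comm Cᶜ, inter_comm C, ← Set.sdiff_eq]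
    refine ENNReal.eq_sub_of_add_eq (measure_ne_top _ _) ?_
    rw [add_comm]
    exact measure_inter_add_sdiff A hCm
  · intro C hdisj hC ih
    choose h hh hint using ih
    refine ⟨fun ω => ∑' i, h i ω, 
    @Measurable.tsum Ω ℝ≥0∞ ℕ (rawNatural X t) _ _ _ _ _ _ _ _ _ _ _ _ hh, fun x A hA => ?_⟩
    rw [lintegral_tsum fun i => ((hh i).mono (rawNatural_le hX t) le_rfl).aemeasurable,
      iUnion_inter, measure_iUnion]
    · exact tsum_congr fun i => hint i x A hA
    · exact fun i j hij => (hdisj hij).mono inter_subset_left inter_subset_left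
    · exact fun i => (rawNatural_le hX r _ (hC i)).inter (rawNaturalRight_le hX t _ hA)

/-- **Blumenthal's zero-one law**: up to null sets, the raw filtration of a process with the
Markov property relative to `𝓕⁰_{t+}` is right continuous. -/
theorem exists_rawNatural_symmDiff_eq_zero (hP : ∀ x, IsProbabilityMeasure (P x))
    (hX : ∀ t, Measurable[m, univBorel (WithCemetery E)] (X t))
    (htr : ∀ t, ∀ g : E → ℝ≥0∞, Measurable[univBorel E] g →
      Measurable[univBorel E] (ltransition X P t g))
    (hmk : ∀ (x : E) (s t : ℝ≥0) (g : E → ℝ≥0∞), Measurable[univBorel E] g →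
      ∀ A, MeasurableSet[rawNaturalRight X s] A →
        ∫⁻ ω in A, extendZero g (X (s + t) ω) ∂(P x) =
        ∫⁻ ω in A, extendZero (ltransition X P t g) (X s ω) ∂(P x)) {t : ℝ≥0}
    {B : Set Ω} (hB : MeasurableSet[rawNaturalRight X t] B) :
    ∃ C, MeasurableSet[rawNatural X t] C ∧ ∀ x, P x (symmDiff B C) = 0 := by
  have hle := rawNaturalRight_le hX t
  obtain ⟨h, hh, hint⟩ := exists_rawNatural_condProb hP hX htr hmk t (t + 1)
    (iInf₂_le (f := fun (r : ℝ≥0) (_ : t < r) => rawNatural X r) _ (lt_add_one t) _ hB)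
  have hh' := hh.mono (rawNatural_le_rawNaturalRight X t) le_rfl
  have hBm : Measurable[rawNaturalRight X t] (B.indicator (1 : Ω → ℝ≥0∞)) :=
    measurable_indicator_one (𝓐 := rawNaturalRight X t) hB
  -- As `B` is itself in `𝓕⁰_{t+}`, its conditional probability `h` is a.s. the indicator of `B`.
  refine ⟨h ⁻¹' {1}, hh (measurableSet_singleton 1), fun x => ?_⟩
  have hi : ∀ A, MeasurableSet[rawNaturalRight X t] A →
      ∫⁻ ω in A, B.indicator 1 ω ∂(P x) = ∫⁻ ω in A, h ω ∂(P x) := by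
    intro A hA
    rw [lintegral_indicator_one (hle _ hB), Measure.restrict_apply (hle _ hB), hint x A hA]
  have heq : B.indicator 1 =ᵐ[P x] h := by
    refine (ae_le_of_forall_setLIntegral_le_trim hle hBm hh' fun A hA => (hi A hA).le).antisymm
      (ae_le_of_forall_setLIntegral_le_trim hle hh' hBm fun A hA => (hi A hA).ge)
  rw [measure_symmDiff_eq_zero_iff]
  filter_upwards [heq] with ω hω
  refine propext ⟨fun hB => ?_, fun h1 => ?_⟩
  · exact hω.symm.trans (indicator_of_mem hB _)
  · by_contra hB
    have h0 : h ω = 0 := hω.symm.trans (indicator_of_notMem hB _)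
    exact zero_ne_one (h0.symm.trans h1)

theorem le_augment {𝓐 : MeasurableSpace Ω} (h : 𝓐 ≤ m) : 𝓐 ≤ augment P 𝓐 :=
  fun A hA => ⟨h A hA, fun _ _ => ⟨A, hA, by simp⟩⟩

theorem augment_augment (𝓐 : MeasurableSpace Ω) : augment P (augment P 𝓐) = augment P 𝓐 := by
  refine le_antisymm (fun A hA => ⟨hA.1, fun μ hμ => ?_⟩) (le_augment fun A hA => hA.1)
  obtain ⟨B, hB, hAB⟩ := hA.2 μ hμ
  obtain ⟨C, hC, hBC⟩ := hB.2 μ hμ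
  refine ⟨C, hC, ?_⟩
  filter_upwards [hAB, hBC] with x h1 h2
  exact measure_mono_null (symmDiff_triangle A B C) (measure_union_null h1 h2)

/-- Take raw versions `B k` of `A` at times `t + 1/(k+1)`. Their limsup lies in `𝓕⁰_{t+}` and still
differs from `A` by a null set; the hypothesis then moves it into `𝓕⁰_t`. -/
theorem isRightContinuous_naturalFiltration
    (h : ∀ t B, MeasurableSet[rawNaturalRight X t] B →
      ∃ C, MeasurableSet[rawNatural X t] C ∧ ∀ x, P x (symmDiff B C) = 0) :
    (naturalFiltration P X).IsRightContinuous := by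
  refine ⟨fun t A hA => ?_⟩
  rw [Filtration.rightCont_eq] at hA
  have hA' : ∀ r, t < r → MeasurableSet[augment P (rawNatural X r)] A := fun r hr =>
    iInf₂_le (f := fun (r : ℝ≥0) (_ : r > t) => naturalFiltration P X r) r hr _ hA
  refine ⟨(hA' _ (lt_add_one t)).1, fun μ hμ => ?_⟩
  have hpos : ∀ k : ℕ, t < t + ((k : ℝ≥0) + 1)⁻¹ := fun k =>
    lt_add_of_pos_right _ (by positivity)
  choose B hB hAB using fun k => (hA' _ (hpos k)).2 μ hμ
  have hanti : Antitone fun k : ℕ => t + ((k : ℝ≥0) + 1)⁻¹ := fun i j hij =>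
    add_le_add le_rfl (inv_anti₀ (by positivity) (by gcongr))
  have hD : MeasurableSet[rawNaturalRight X t] (⋂ i, ⋃ k, B (i + k)) := by
    simp only [MeasurableSpace.measurableSet_iInf]
    intro r hr
    obtain ⟨N, hN⟩ : ∃ N : ℕ, t + ((N : ℝ≥0) + 1)⁻¹ < r := by
      obtain ⟨N, hN⟩ := exists_nat_one_div_lt (tsub_pos_of_lt hr)
      exact ⟨N, by rwa [← lt_tsub_iff_left, ← one_div]⟩
    -- A limsup is unchanged when the first `N` sets are dropped, and the others are all known by
    -- time `r`.
    have heq : (⋂ i, ⋃ k, B (i + k)) = ⋂ i, ⋃ k, B (N + i + k) := by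
      ext ω
      simp only [mem_iInter, mem_iUnion]
      refine ⟨fun H i => H (N + i), fun H i => ?_⟩
      obtain ⟨k, hk⟩ := H i
      exact ⟨N + k, by rwa [← add_assoc, add_comm i N]⟩
    rw [heq]
    exact MeasurableSet.iInter fun i => MeasurableSet.iUnion fun k =>
      rawNatural_mono X ((hanti (by omega : N ≤ N + i + k)).trans hN.le) _ (hB _)
  obtain ⟨C, hC, hDC⟩ := h t _ hD
  refine ⟨C, hC, ?_⟩
  filter_upwards [ae_all_iff.2 hAB] with x hx
  refine measure_mono_null (symmDiff_triangle A (⋂ i, ⋃ k, B (i + k)) C)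
    (measure_union_null (measure_mono_null ?_ (measure_iUnion_null hx)) (hDC x))
  rintro ω (⟨hω, hω'⟩ | ⟨hω, hω'⟩)
  · simp only [mem_iInter, mem_iUnion, not_forall, not_exists] at hω'
    obtain ⟨i, hi⟩ := hω'
    exact mem_iUnion.2 ⟨i + 0, Or.inl ⟨hω, hi 0⟩⟩
  · obtain ⟨k, hk⟩ := mem_iUnion.1 (mem_iInter.1 hω 0)
    exact mem_iUnion.2 ⟨0 + k, Or.inr ⟨hk, hω'⟩⟩

end NaturalFiltration

/-! ### Killing at a random time -/

section Kill

variable {Ω : Type v} {E : Type u} {X : ℝ≥0 → Ω → WithCemetery E}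

theorem kill_of_lt {R : Ω → ℝ≥0∞} {t : ℝ≥0} {ω : Ω} (h : (t : ℝ≥0∞) < R ω) :
    kill X R t ω = X t ω := if_pos h

theorem kill_of_le {R : Ω → ℝ≥0∞} {t : ℝ≥0} {ω : Ω} (h : R ω ≤ t) :
    kill X R t ω = cemetery := if_neg h.not_gt

theorem kill_eq_inl {R : Ω → ℝ≥0∞} {t : ℝ≥0} {ω : Ω} {x : E} (h : kill X R t ω = Sum.inl x) :
    (t : ℝ≥0∞) < R ω ∧ X t ω = Sum.inl x := by
  by_cases hlt : (t : ℝ≥0∞) < R ω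
  · exact ⟨hlt, (kill_of_lt hlt).symm.trans h⟩
  · rw [kill_of_le (not_lt.1 hlt)] at h
    exact absurd h (by simp [cemetery])

/-- The set `{t < R}` is open in `t`, so the killed path agrees with the original one nearby; from
`R` on it is constant. -/
theorem continuousWithinAt_kill {β : Type*} [TopologicalSpace β] (φ : WithCemetery E → β)
    {R : Ω → ℝ≥0∞} {t : ℝ≥0} {ω : Ω}
    (h : (t : ℝ≥0∞) < R ω → ContinuousWithinAt (fun s => φ (X s ω)) (Ici t) t) :
    ContinuousWithinAt (fun s => φ (kill X R s ω)) (Ici t) t := by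
  by_cases hlt : (t : ℝ≥0∞) < R ω
  · refine (h hlt).congr_of_eventuallyEq ?_ (by rw [kill_of_lt hlt])
    have : ∀ᶠ s : ℝ≥0 in 𝓝 t, (s : ℝ≥0∞) < R ω :=
      ENNReal.continuous_coe.continuousAt.eventually (Iio_mem_nhds hlt)
    filter_upwards [mem_nhdsWithin_of_mem_nhds this] with s hs
    rw [kill_of_lt hs]
  · have hle := not_lt.1 hlt
    refine (continuousWithinAt_const : ContinuousWithinAt (fun _ => φ cemetery) (Ici t) t).congr
      (fun s hs => ?_) ?_
    · rw [kill_of_le (hle.trans (ENNReal.coe_le_coe.2 hs))]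
    · rw [kill_of_le hle]

theorem measurable_kill [TopologicalSpace E] {𝓐 : MeasurableSpace Ω} {R : Ω → ℝ≥0∞} {t : ℝ≥0}
    (hX : Measurable[𝓐, univBorel (WithCemetery E)] (X t))
    (hR : MeasurableSet[𝓐] {ω | (t : ℝ≥0∞) < R ω}) :
    Measurable[𝓐, univBorel (WithCemetery E)] (kill X R t) := by
  let _ : MeasurableSpace (WithCemetery E) := univBorel _
  classical
  refine Measurable.ite hR hX measurable_const

variable {R : ℕ → Ω → ℝ≥0∞}

theorem extendZero_kill_mono {S T : Ω → ℝ≥0∞} {ω : Ω} (h : S ω ≤ T ω) (g : E → ℝ≥0∞)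
    (t : ℝ≥0) : extendZero g (kill X S t ω) ≤ extendZero g (kill X T t ω) := by
  by_cases hlt : (t : ℝ≥0∞) < S ω
  · rw [kill_of_lt hlt, kill_of_lt (hlt.trans_le h)]
  · rw [kill_of_le (not_lt.1 hlt)]
    exact zero_le

theorem extendZero_kill_iSup (g : E → ℝ≥0∞) (t : ℝ≥0) (ω : Ω) :
    extendZero g (kill X (fun ω => ⨆ n, R n ω) t ω) = ⨆ n, extendZero g (kill X (R n) t ω) := by
  refine le_antisymm ?_ (iSup_le fun n =>
    extendZero_kill_mono (T := fun ω => ⨆ n, R n ω) (le_iSup (fun n => R n ω) n) g t)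
  by_cases hlt : (t : ℝ≥0∞) < ⨆ n, R n ω
  · obtain ⟨n, hn⟩ := lt_iSup_iff.1 hlt
    refine le_iSup_of_le n ?_
    rw [kill_of_lt hn, kill_of_lt (R := fun ω => ⨆ n, R n ω) hlt]
  · rw [kill_of_le (R := fun ω => ⨆ n, R n ω) (not_lt.1 hlt)]
    exact zero_le

end Kill

/-! ### Processes on a subspace viewed in the whole space -/

section Subspace

variable {Ω : Type v} {E : Type u} {A : Set E} {Y : ℝ≥0 → Ω → WithCemetery A}
  {W : ℝ≥0 → Ω → WithCemetery E}

theorem extendZero_restrict {β : Type*} [Zero β]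
    (hY : ∀ t ω, Sum.map Subtype.val id (Y t ω) = W t ω) (f : E → β) (t : ℝ≥0) (ω : Ω) :
    extendZero (fun x : A => f x) (Y t ω) = extendZero f (W t ω) := by
  rw [← hY]
  rcases Y t ω with y | y <;> rfl

variable {m : MeasurableSpace Ω} {P : E → Measure Ω}

theorem ltransition_restrict (hY : ∀ t ω, Sum.map Subtype.val id (Y t ω) = W t ω)
    (t : ℝ≥0) (f : E → ℝ≥0∞) :
    ltransition Y (fun x : A => P x) t (fun x : A => f x) =
      fun x : A => ltransition W P t f x :=
  funext fun _ => lintegral_congr fun ω => extendZero_restrict hY f t ω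

variable [TopologicalSpace E]

theorem measurable_restrict {𝓐 : MeasurableSpace Ω} {t : ℝ≥0}
    (hY : ∀ t ω, Sum.map Subtype.val id (Y t ω) = W t ω)
    (h : Measurable[𝓐, univBorel (WithCemetery A)] (Y t)) :
    Measurable[𝓐, univBorel (WithCemetery E)] (W t) := by
  rw [← funext (hY t)]
  exact (measurable_univBorel_of_continuous
    (continuous_subtype_val.sumMap continuous_id)).comp h

end Subspace

/-! ### Localizing the Markov property before a killing time -/

section LocalProperties

variable {Ω : Type v} {E : Type u} [TopologicalSpace E] {A : Set E}
  {Y : ℝ≥0 → Ω → WithCemetery A} {X : ℝ≥0 → Ω → WithCemetery E} {m : MeasurableSpace Ω}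
  {P : E → Measure Ω} {𝓖 : Filtration ℝ≥0 m} {Θ : ℝ≥0∞ → Ω → Ω} {S T : Ω → ℝ≥0∞}

/-- On `{q < S}` the processes killed at `S` and at `T` coincide up to time `q`. -/
theorem measurableSet_inter_lt_of_rawNatural
    (hY : ∀ t ω, Sum.map Subtype.val id (Y t ω) = kill X S t ω)
    (hadapt : ∀ t, Measurable[𝓖 t, univBorel (WithCemetery A)] (Y t))
    (hS : IsStoppingTime 𝓖 S) (hST : S ≤ T) {q : ℝ≥0} {B : Set Ω}
    (hB : MeasurableSet[rawNatural (kill X T) q] B) :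
    MeasurableSet[𝓖 q] (B ∩ {ω | (q : ℝ≥0∞) < S ω}) := by
  set D : Set Ω := {ω | (q : ℝ≥0∞) < S ω} with hD
  have hDm : MeasurableSet[𝓖 q] D := by
    have : D = {ω | S ω ≤ (q : ℝ≥0∞)}ᶜ := by
      ext ω
      simp [hD]
    rw [this]
    exact (hS q).compl
  -- The right side consists of the sets whose trace on `D` is the trace of a set of `𝓖 q`. It is a
  -- `σ`-algebra, so generators suffice.
  have hle : rawNatural (kill X T) q ≤
      ((𝓖 q : MeasurableSpace Ω).comap (Subtype.val : D → Ω)).map Subtype.val := by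
    refine iSup₂_le fun r hr => ?_
    rintro _ ⟨C, hC, rfl⟩
    refine ⟨kill X S r ⁻¹' C,
      (measurable_restrict hY ((hadapt r).mono (𝓖.mono hr) le_rfl)) hC, ?_⟩
    ext ⟨ω, hω⟩
    have h1 : (r : ℝ≥0∞) < S ω := (ENNReal.coe_le_coe.2 hr).trans_lt hω
    simp only [mem_preimage]
    rw [kill_of_lt h1, kill_of_lt (h1.trans_le (hST ω))]
  obtain ⟨C, hC, h⟩ := hle B hB
  have : B ∩ D = C ∩ D := by
    ext ω
    simp only [mem_inter_iff, and_congr_left_iff]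
    intro hω
    exact (Set.ext_iff.1 h ⟨ω, hω⟩).symm
  rw [this]
  exact MeasurableSet.inter hC hDm

/-- Write `{s < S}` as the union of `{u j < S}` for `u j ↓ s` strictly. Each piece is known at time
`u j`, and right continuity of `𝓖` lets these times decrease to `s`. -/
theorem measurableSet_inter_lt_of_rawNaturalRight
    (hY : ∀ t ω, Sum.map Subtype.val id (Y t ω) = kill X S t ω)
    (hadapt : ∀ t, Measurable[𝓖 t, univBorel (WithCemetery A)] (Y t))
    (hrc : 𝓖.IsRightContinuous)
    (hS : IsStoppingTime 𝓖 S) (hST : S ≤ T) {s : ℝ≥0} {B : Set Ω}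
    (hB : MeasurableSet[rawNaturalRight (kill X T) s] B) :
    MeasurableSet[𝓖 s] (B ∩ {ω | (s : ℝ≥0∞) < S ω}) := by
  refine hrc.measurableSet ?_
  rw [Filtration.rightCont_eq]
  simp only [MeasurableSpace.measurableSet_iInf] at hB ⊢
  intro r hr
  obtain ⟨u, -, hu, hlim⟩ := exists_seq_strictAnti_tendsto' hr
  have heq : B ∩ {ω | (s : ℝ≥0∞) < S ω} = ⋃ j, B ∩ {ω | (u j : ℝ≥0∞) < S ω} := by
    ext ω
    simp only [mem_inter_iff, mem_ofPred_eq, mem_iUnion, exists_and_left, and_congr_right_iff]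
    refine fun _ => ⟨fun h => ?_, fun ⟨j, hj⟩ => (ENNReal.coe_lt_coe.2 (hu j).1).trans hj⟩
    exact ((ENNReal.tendsto_coe.2 hlim).eventually (Iio_mem_nhds h)).exists
  rw [heq]
  exact MeasurableSet.iUnion fun j => 𝓖.mono (hu j).2.le _
    (measurableSet_inter_lt_of_rawNatural hY hadapt hS hST (hB _ (hu j).1))

theorem measurable_extendZero_ltransition_kill
    (hY : ∀ t ω, Sum.map Subtype.val id (Y t ω) = kill X S t ω)
    (hM : IsMarkovProcess 𝓖 Y Θ fun x : A => P x) (s t : ℝ≥0) {g : E → ℝ≥0∞}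
    (hg : Measurable[univBorel E] g) :
    Measurable[univBorel A] (fun x : A => ltransition (kill X S) P t g x) ∧
    Measurable[m] fun ω => extendZero (ltransition (kill X S) P t g) (kill X S s ω) := by
  have hYm : ∀ t, Measurable[m, univBorel (WithCemetery A)] (Y t) := fun t =>
    (hM.adapted t).mono (𝓖.le t) le_rfl
  have h : Measurable[univBorel A] (fun x : A => ltransition (kill X S) P t g x) := by
    rw [← ltransition_restrict hY]
    exact measurable_ltransition (hYm t) (hM.measurable_transition t)
      (hg.comp (measurable_univBorel_of_continuous continuous_subtype_val))
  refine ⟨h, ?_⟩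
  simp_rw [← extendZero_restrict hY]
  exact measurable_extendZero_comp (hYm s) h

/-- Both integrands vanish on `{S ≤ s}`, so `B` may be replaced by `B ∩ {s < S}`, an event of `𝓖 s`.
-/
theorem setLIntegral_kill
    (hY : ∀ t ω, Sum.map Subtype.val id (Y t ω) = kill X S t ω)
    (hM : IsMarkovProcess 𝓖 Y Θ fun x : A => P x) (hrc : 𝓖.IsRightContinuous)
    (hS : IsStoppingTime 𝓖 S) (hST : S ≤ T) (s t : ℝ≥0) {g : E → ℝ≥0∞}
    (hg : Measurable[univBorel E] g) {B : Set Ω}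
    (hB : MeasurableSet[rawNaturalRight (kill X T) s] B)
    {x : E} (hx : x ∈ A) :
    ∫⁻ ω in B, extendZero g (kill X S (s + t) ω) ∂(P x) =
      ∫⁻ ω in B, extendZero (ltransition (kill X S) P t g) (kill X S s ω) ∂(P x) := by
  have hBm := measurableSet_inter_lt_of_rawNaturalRight hY hM.adapted hrc hS hST hB
  have h := hM.setLIntegral ⟨x, hx⟩ s t
    (hg.comp (measurable_univBorel_of_continuous continuous_subtype_val)) hBm
  have e := ltransition_restrict (P := P) hY t g
  simp only [Function.comp_def] at h
  rw [e] at h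
  simp_rw [extendZero_restrict hY] at h
  have hD : MeasurableSet {ω | (s : ℝ≥0∞) < S ω} := by
    have : {ω | (s : ℝ≥0∞) < S ω} = {ω | S ω ≤ (s : ℝ≥0∞)}ᶜ := by
      ext ω
      simp
    rw [this]
    exact (𝓖.le s _ (hS s)).compl
  have key : ∀ F : Ω → ℝ≥0∞, (∀ ω, S ω ≤ s → F ω = 0) →
      ∫⁻ ω in B, F ω ∂(P x) = ∫⁻ ω in B ∩ {ω | (s : ℝ≥0∞) < S ω}, F ω ∂(P x) := by
    intro F hF
    rw [inter_comm, ← Measure.restrict_restrict hD, ← lintegral_indicator hD]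
    refine lintegral_congr fun ω => ?_
    by_cases hω : (s : ℝ≥0∞) < S ω
    · exact (indicator_of_mem (s := {ω | (s : ℝ≥0∞) < S ω}) hω F).symm
    · rw [hF ω (not_lt.1 hω)]
      exact (indicator_of_notMem (s := {ω | (s : ℝ≥0∞) < S ω}) hω F).symm
  rw [key _ fun ω hω => ?_, key _ fun ω hω => ?_, h]
  · rw [kill_of_le hω, extendZero_cemetery]
  · rw [kill_of_le (hω.trans (ENNReal.coe_le_coe.2 le_self_add)), extendZero_cemetery]

end LocalProperties

/-! ### Excessive functions under earlier killing -/

section Excessive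

variable {Ω : Type v} {E : Type u} [TopologicalSpace E] {m : MeasurableSpace Ω}
  {P : E → Measure Ω} {X : ℝ≥0 → Ω → WithCemetery E}

theorem IsExcessive.le {α : ℝ≥0} {f : E → ℝ≥0∞} (h : IsExcessive X P α f) {t : ℝ≥0}
    (ht : 0 < t) (x : E) :
    ENNReal.ofReal (Real.exp (-(α * t : ℝ))) * ltransition X P t f x ≤ f x := by
  refine ge_of_tendsto (h.tendsto x) ?_
  filter_upwards [Ioc_mem_nhdsGT ht] with s hs
  exact h.antitone x hs.1 ht hs.2

theorem ofReal_exp_neg_le_one (α t : ℝ≥0) : ENNReal.ofReal (Real.exp (-(α * t : ℝ))) ≤ 1 := by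
  rw [ENNReal.ofReal_le_one, Real.exp_le_one_iff, neg_nonpos]
  positivity

theorem tendsto_measure_le_inv {μ : Measure Ω} [IsFiniteMeasure μ] {S : Ω → ℝ≥0∞}
    (hS : ∀ t : ℝ≥0, MeasurableSet {ω | S ω ≤ t}) (hpos : ∀ᵐ ω ∂μ, 0 < S ω) :
    Tendsto (fun j : ℕ => μ {ω | S ω ≤ (((j : ℝ≥0) + 1)⁻¹ : ℝ≥0)}) atTop (𝓝 0) := by
  have hanti : Antitone fun j : ℕ => {ω | S ω ≤ (((j : ℝ≥0) + 1)⁻¹ : ℝ≥0)} := by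
    intro i j hij ω hω
    refine le_trans hω (ENNReal.coe_le_coe.2 (inv_anti₀ (by positivity) (by gcongr)))
  have h := tendsto_measure_iInter_atTop (μ := μ)
    (fun j : ℕ => (hS (((j : ℝ≥0) + 1)⁻¹)).nullMeasurableSet) hanti ⟨0, measure_ne_top _ _⟩
  have h0 : μ (⋂ j : ℕ, {ω | S ω ≤ (((j : ℝ≥0) + 1)⁻¹ : ℝ≥0)}) = 0 := by
    refine measure_mono_null (fun ω hω => ?_) (ae_iff.1 hpos)
    simp only [mem_iInter] at hω
    have hlim : Tendsto (fun j : ℕ => ((((j : ℝ≥0) + 1)⁻¹ : ℝ≥0) : ℝ≥0∞)) atTop (𝓝 0) := by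
      rw [← ENNReal.coe_zero, ENNReal.tendsto_coe]
      simpa using tendsto_one_div_add_atTop_nhds_zero_nat (𝕜 := ℝ≥0)
    exact not_lt.2 (ge_of_tendsto' hlim fun j => hω j)
  rwa [h0] at h

variable {A : Set E} {Y : ℝ≥0 → Ω → WithCemetery A} {𝓖 𝓕 : Filtration ℝ≥0 m}
  {Θ Θ' : ℝ≥0∞ → Ω → Ω} {S T : Ω → ℝ≥0∞}

/-- An excessive function remains excessive when the process is killed earlier, at a time which
is a.s. positive. -/
theorem IsExcessive.restrict_kill {α : ℝ≥0} {f : E → ℝ≥0∞}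
    (hf : IsExcessive (kill X T) P α f) (hZ : IsMarkovProcess 𝓕 (kill X T) Θ P)
    (hY : ∀ t ω, Sum.map Subtype.val id (Y t ω) = kill X S t ω)
    (hM : IsMarkovProcess 𝓖 Y Θ' fun x : A => P x)
    (hS : ∀ t : ℝ≥0, MeasurableSet {ω | S ω ≤ t}) (hST : S ≤ T)
    (hpos : ∀ x ∈ A, ∀ᵐ ω ∂(P x), 0 < S ω) :
    IsExcessive Y (fun x : A => P x) α fun x : A => f x := by
  have hP := hZ.probability
  have hWZ : ∀ t x, ltransition (kill X S) P t f x ≤ ltransition (kill X T) P t f x :=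
    fun t x => lintegral_mono fun ω => extendZero_kill_mono (hST ω) f t
  have hfm : Measurable[univBorel A] fun x : A => f x :=
    hf.measurable.comp (measurable_univBorel_of_continuous continuous_subtype_val)
  have hr := fun t => ltransition_restrict (P := P) hY t f
  have hsup : ∀ t : ℝ≥0, 0 < t → ∀ x : A, ENNReal.ofReal (Real.exp (-(α * t : ℝ))) *
      ltransition Y (fun x : A => P x) t (fun x : A => f x) x ≤ f x := by
    intro t ht x
    rw [hr]
    exact (mul_le_mul_right (hWZ t x) _).trans (hf.le ht x)
  have hanti := hM.antitone_of_supermedian hfm hsup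
  refine ⟨hfm, hanti, fun x => ?_⟩
  refine tendsto_order.2 ⟨fun a ha => ?_, fun a ha => ?_⟩
  swap
  · filter_upwards [self_mem_nhdsWithin] with t ht
    exact (hsup t ht x).trans_lt ha
  -- By monotonicity in time, one value above `a` forces all values at earlier times above `a`.
  suffices h : ∃ s : ℝ≥0, 0 < s ∧ a < ENNReal.ofReal (Real.exp (-(α * s : ℝ))) *
      ltransition Y (fun x : A => P x) s (fun x : A => f x) x by
    obtain ⟨s, hs, has⟩ := h
    filter_upwards [Ioc_mem_nhdsGT hs] with r hr
    exact has.trans_le (hanti x hr.1 hs hr.2)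
  obtain ⟨t, hat, ht⟩ := (((tendsto_order.1 (hf.tendsto x)).1 a ha).and
    self_mem_nhdsWithin).exists
  have hfk : ∀ k : ℕ, Measurable[univBorel E] fun y => min (f y) (k : ℝ≥0∞) := fun k => by
    let _ : MeasurableSpace E := univBorel E
    exact hf.measurable.min measurable_const
  have hZm : ∀ t, Measurable[m, univBorel (WithCemetery E)] (kill X T t) := fun t =>
    (hZ.adapted t).mono (𝓕.le t) le_rfl
  have hfs : ltransition (kill X T) P t f x =
      ⨆ k : ℕ, ltransition (kill X T) P t (fun y => min (f y) (k : ℝ≥0∞)) x := by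
    rw [← ltransition_iSup (hZm t) hfk fun i j hij y => min_le_min le_rfl (by simpa)]
    congr 1
    funext y
    rw [← inf_iSup_eq, ENNReal.iSup_natCast, inf_top_eq]
  -- Truncating `f` at a level `k` keeps the value at `t` above `a` and makes the loss from killing
  -- before time `s` at most `k * P x {S ≤ s}`.
  rw [hfs, ENNReal.mul_iSup] at hat
  obtain ⟨k, hk⟩ := lt_iSup_iff.1 hat
  have hsupk : ∀ t : ℝ≥0, 0 < t → ∀ x, ENNReal.ofReal (Real.exp (-(α * t : ℝ))) *
      ltransition (kill X T) P t (fun y => min (f y) (k : ℝ≥0∞)) x ≤ min (f x) k := by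
    intro t ht x
    refine le_min ?_ ?_
    · exact (mul_le_mul_right (ltransition_mono t (fun y => min_le_left _ _) x) _).trans
        (hf.le ht x)
    · exact (mul_le_mul' (ofReal_exp_neg_le_one α t)
        (ltransition_le_of_le hP t (fun y => min_le_right _ _) x)).trans (one_mul _).le
  have hantik := hZ.antitone_of_supermedian (hfk k) hsupk x
  by_contra! hcon
  -- The left side does not involve `s`; letting `s ↓ 0` removes the error term, since `S > 0` a.s.,
  -- and contradicts the choice of `k`.
  have hbound : ∀ s : ℝ≥0, 0 < s → s ≤ t → ENNReal.ofReal (Real.exp (-(α * t : ℝ))) *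
      ltransition (kill X T) P t (fun y => min (f y) (k : ℝ≥0∞)) x ≤
      a + k * P x {ω | S ω ≤ s} := by
    intro s hs hst
    refine (hantik hs ht hst).trans ?_
    have h1 : ltransition (kill X T) P s (fun y => min (f y) (k : ℝ≥0∞)) x ≤
        ltransition (kill X S) P s f x + k * P x {ω | S ω ≤ s} := by
      unfold ltransition
      rw [← lintegral_indicator_const (hS s),
        ← lintegral_add_right _ (measurable_const.indicator (hS s))]
      refine lintegral_mono fun ω => ?_
      by_cases hω : S ω ≤ s
      · rw [indicator_of_mem (s := {ω | S ω ≤ s}) hω]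
        refine le_add_left ?_
        rcases kill X T s ω with y | y
        · exact min_le_right _ _
        · exact zero_le
      · rw [indicator_of_notMem (s := {ω | S ω ≤ s}) hω, add_zero]
        have hlt := not_le.1 hω
        rw [kill_of_lt hlt, kill_of_lt (hlt.trans_le (hST ω))]
        exact extendZero_mono (fun y => min_le_left _ _) _
    have h2 := hcon s hs
    rw [hr] at h2
    calc _ ≤ ENNReal.ofReal (Real.exp (-(α * s : ℝ))) *
          (ltransition (kill X S) P s f x + k * P x {ω | S ω ≤ s}) := mul_le_mul_right h1 _
      _ ≤ a + k * P x {ω | S ω ≤ s} := by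
        rw [mul_add]
        exact add_le_add h2 ((mul_le_mul_left (ofReal_exp_neg_le_one α s) _).trans
          (one_mul _).le)
  have hlim := tendsto_measure_le_inv (μ := P x) hS (hpos x x.2)
  have hlim' : Tendsto (fun j : ℕ => a + k * P x {ω | S ω ≤ (((j : ℝ≥0) + 1)⁻¹ : ℝ≥0)})
      atTop (𝓝 (a + k * 0)) :=
    tendsto_const_nhds.add (ENNReal.Tendsto.const_mul hlim
      (Or.inr (ENNReal.natCast_ne_top k)))
  rw [mul_zero, add_zero] at hlim'
  refine hk.not_ge (ge_of_tendsto hlim' ?_)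
  have hsmall : ∀ᶠ j : ℕ in atTop, ((j : ℝ≥0) + 1)⁻¹ < t := by
    have := tendsto_one_div_add_atTop_nhds_zero_nat (𝕜 := ℝ≥0)
    simpa using this.eventually (Iio_mem_nhds ht)
  filter_upwards [hsmall] with j hj
  exact hbound _ (by positivity) hj.le

end Excessive

end RightProc

/-! ### The limit process is a right process -/

open RightProc in
theorem mainTheorem6 {E : Type*} [TopologicalSpace E] {Ω : Type*} {m : MeasurableSpace Ω}
    (hE : IsRadonSpace E)
    (P : E → Measure Ω) (hP : ∀ x, IsProbabilityMeasure (P x))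
    (X : ℝ≥0 → Ω → WithCemetery E)
    (hXmeas : ∀ t, Measurable[m, univBorel (WithCemetery E)] (X t))
    (hXrc : ∀ ω t, ContinuousWithinAt (fun s => X s ω) (Ici t) t)
    (R : ℕ → Ω → ℝ≥0∞) (hRmono : ∀ ω, Monotone fun n => R n ω)
    (ER : ℕ → Set E) (hERradon : ∀ n, IsRadonSpace (ER n))
    (hERmono : Monotone ER) (hERunion : ⋃ n, ER n = univ)
    (Θ : ℝ≥0∞ → Ω → Ω) (hΘ : IsShiftFamily (kill X fun ω => ⨆ n, R n ω) Θ)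
    (hRstop : ∀ n, IsStoppingTime (naturalFiltration P (kill X fun ω => ⨆ n, R n ω)) (R n))
    (hsub : ∀ n, ∃ (𝓖 : Filtration ℝ≥0 m) (Θn : ℝ≥0∞ → Ω → Ω)
      (Y : ℝ≥0 → Ω → WithCemetery (ER n)),
      (∀ t ω, Sum.map Subtype.val id (Y t ω) = kill X (R n) t ω) ∧
      IsRightProcess 𝓖 Y Θn (fun x : ER n => P x) ∧
      IsTerminalTime 𝓖 Θn (R n) ∧
      ∀ x ∈ ER n, ∀ᵐ ω ∂(P x), 0 < R n ω) :
    IsRightProcess (naturalFiltration P (kill X fun ω => ⨆ n, R n ω))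
      (kill X fun ω => ⨆ n, R n ω) Θ P := by
  have := hE.t2Space
  choose 𝓖 Θn Y hY hYright hterm hpos using hsub
  have hYM : ∀ n, IsMarkovProcess (𝓖 n) (Y n) (Θn n) fun x : ER n => P x := fun n =>
    { hYright n with }
  set T : Ω → ℝ≥0∞ := fun ω => ⨆ n, R n ω with hT
  have hRT : ∀ n, R n ≤ T := fun n ω => le_iSup (fun n => R n ω) n
  have hRle : ∀ n (t : ℝ≥0), MeasurableSet {ω | R n ω ≤ t} := fun n t =>
    (naturalFiltration P (kill X T)).le t _ (hRstop n t)
  have hlt : ∀ n (t : ℝ≥0), MeasurableSet {ω | (t : ℝ≥0∞) < R n ω} := fun n t => by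
    have : {ω | (t : ℝ≥0∞) < R n ω} = {ω | R n ω ≤ t}ᶜ := by
      ext ω
      simp
    rw [this]
    exact (hRle n t).compl
  have hTlt : ∀ t : ℝ≥0, MeasurableSet {ω | (t : ℝ≥0∞) < T ω} := fun t => by
    have : {ω | (t : ℝ≥0∞) < T ω} = ⋃ n, {ω | (t : ℝ≥0∞) < R n ω} := by
      ext ω
      simp [hT, lt_iSup_iff]
    rw [this]
    exact MeasurableSet.iUnion fun n => hlt n t
  have hZ : ∀ t, Measurable[m, univBorel (WithCemetery E)] (kill X T t) := fun t =>
    measurable_kill (hXmeas t) (hTlt t)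
  have hW : ∀ n t, Measurable[m, univBorel (WithCemetery E)] (kill X (R n) t) := fun n t =>
    measurable_kill (hXmeas t) (hlt n t)
  have hERm : ∀ n, MeasurableSet[univBorel E] (ER n) := fun n =>
    measurableSet_of_isRadonSpace (hERradon n)
  have hmem : ∀ x : E, ∃ n, x ∈ ER n := fun x => mem_iUnion.1 (hERunion ▸ mem_univ x)
  have hkmono : ∀ (g : E → ℝ≥0∞) t ω, Monotone fun n => extendZero g (kill X (R n) t ω) :=
    fun g t ω i j hij => extendZero_kill_mono (hRmono ω hij) g t
  have hltmono : ∀ (g : E → ℝ≥0∞) t x, Monotone fun n => ltransition (kill X (R n)) P t g x :=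
    fun g t x i j hij => lintegral_mono fun ω => hkmono g t ω hij
  have hltsup : ∀ (t : ℝ≥0) (g : E → ℝ≥0∞), Measurable[univBorel E] g → ∀ x,
      ltransition (kill X T) P t g x = ⨆ n, ltransition (kill X (R n)) P t g x := by
    intro t g hg x
    unfold ltransition
    rw [← lintegral_iSup (fun n => measurable_extendZero_comp (hW n t) hg)
      fun i j hij ω => hkmono g t ω hij]
    exact lintegral_congr fun ω => extendZero_kill_iSup g t ω
  have htr : ∀ t, ∀ g : E → ℝ≥0∞, Measurable[univBorel E] g →
      Measurable[univBorel E] (ltransition (kill X T) P t g) := by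
    intro t g hg
    refine measurable_of_cover_univBorel hERm hERunion fun n => ?_
    -- The index is shifted by `n` because only the processes on `ER (k + n) ⊇ ER n` are controlled
    -- from starting points in `ER n`.
    have : (fun x : ER n => ltransition (kill X T) P t g x) =
        fun x : ER n => ⨆ k, ltransition (kill X (R (k + n))) P t g x := by
      funext x
      rw [hltsup t g hg x, ← (hltmono g t x).iSup_nat_add n]
    rw [this]
    let _ : MeasurableSpace (ER n) := univBorel (ER n)
    refine Measurable.iSup fun k => ?_
    exact (measurable_extendZero_ltransition_kill (hY (k + n))
      (hYM (k + n)) 0 t hg).1.comp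
      (measurable_univBorel_of_continuous
        (continuous_inclusion (hERmono (Nat.le_add_left n k))))
  have hmk : ∀ (x : E) (s t : ℝ≥0) (g : E → ℝ≥0∞), Measurable[univBorel E] g →
      ∀ A, MeasurableSet[rawNaturalRight (kill X T) s] A →
        ∫⁻ ω in A, extendZero g (kill X T (s + t) ω) ∂(P x) =
        ∫⁻ ω in A, extendZero (ltransition (kill X T) P t g) (kill X T s ω) ∂(P x) := by
    intro x s t g hg A hA
    obtain ⟨n, hx⟩ := hmem x
    have hmonoF : Monotone fun k ω =>
        extendZero (ltransition (kill X (R k)) P t g) (kill X (R k) s ω) := fun i j hij ω =>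
      (hkmono _ s ω hij).trans (extendZero_mono (fun x => hltmono g t x hij) _)
    calc ∫⁻ ω in A, extendZero g (kill X T (s + t) ω) ∂(P x)
        = ∫⁻ ω in A, ⨆ k, extendZero g (kill X (R k) (s + t) ω) ∂(P x) :=
          lintegral_congr fun ω => extendZero_kill_iSup g _ ω
      _ = ⨆ k, ∫⁻ ω in A, extendZero g (kill X (R k) (s + t) ω) ∂(P x) :=
          lintegral_iSup (fun k => measurable_extendZero_comp (hW k _) hg)
            fun i j hij ω => hkmono g _ ω hij
      _ = ⨆ k, ∫⁻ ω in A, extendZero g (kill X (R (k + n)) (s + t) ω) ∂(P x) :=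
          (Monotone.iSup_nat_add (fun i j hij => lintegral_mono fun ω => hkmono g _ ω hij)
            n).symm
      _ = ⨆ k, ∫⁻ ω in A, extendZero (ltransition (kill X (R (k + n))) P t g)
            (kill X (R (k + n)) s ω) ∂(P x) :=
          iSup_congr fun k => setLIntegral_kill (hY (k + n)) (hYM _)
            (hYright _).filtration_rightContinuous (hterm _).isStoppingTime (hRT _) s t hg hA
            (hERmono (Nat.le_add_left n k) hx)
      _ = ⨆ k, ∫⁻ ω in A, extendZero (ltransition (kill X (R k)) P t g)
            (kill X (R k) s ω) ∂(P x) :=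
          Monotone.iSup_nat_add (f := fun k => ∫⁻ ω in A,
            extendZero (ltransition (kill X (R k)) P t g) (kill X (R k) s ω) ∂(P x))
            (fun i j hij => lintegral_mono (hmonoF hij)) n
      _ = ∫⁻ ω in A, ⨆ k, extendZero (ltransition (kill X (R k)) P t g)
            (kill X (R k) s ω) ∂(P x) :=
          (lintegral_iSup (fun k => (measurable_extendZero_ltransition_kill (hY k)
            (hYM k) s t hg).2) hmonoF).symm
      _ = ∫⁻ ω in A, extendZero (ltransition (kill X T) P t g) (kill X T s ω) ∂(P x) := by
          refine lintegral_congr fun ω => ?_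
          rw [extendZero_kill_iSup, funext (hltsup t g hg)]
          simp only [extendZero_iSup]
          -- The operator and the killed process each contribute an index; monotonicity in both
          -- reduces the double supremum to the diagonal.
          refine le_antisymm (iSup_le fun k => le_iSup₂_of_le k k le_rfl)
            (iSup₂_le fun j k => le_iSup_of_le (max j k) ?_)
          exact (hkmono _ s ω (le_max_left j k)).trans
            (extendZero_mono (fun x => hltmono g t x (le_max_right j k)) _)
  have hMarkov : IsMarkovProcess (naturalFiltration P (kill X T)) (kill X T) Θ P := by
    refine ⟨hP, fun ω t => ?_, fun t => ?_, hΘ, fun ω t ht => ?_, fun x => ?_,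
      fun t B hB => ?_, fun x s t f hf hC => ?_⟩
    · exact continuousWithinAt_kill id fun _ => hXrc ω t
    · exact (measurable_rawNatural (kill X T) le_rfl).mono (le_augment (rawNatural_le hZ t))
        le_rfl
    -- If `Z` were alive at `t`, then `t < R n` for some `n`. Since `Zⁿ` is dead whenever `Z` is,
    -- its lifetime is at most `t`, so `Zⁿ`, which equals `Z` at time `t`, would be dead there.
    · by_contra hne
      have htT : (t : ℝ≥0∞) < T ω := by
        by_contra h
        exact hne (kill_of_le (not_lt.1 h))
      obtain ⟨n, hn⟩ := lt_iSup_iff.1 htT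
      have hcem : ∀ s : ℝ≥0, Y n s ω = cemetery ↔ kill X (R n) s ω = cemetery := by
        intro s
        rw [← hY n s ω]
        rcases Y n s ω with y | y <;> simp [cemetery]
      have hlife : lifetime (Y n) ω ≤ t := by
        refine le_trans (le_iInf₂ fun s hs => iInf₂_le s ((hcem s).2 ?_)) ht
        by_cases hsn : (s : ℝ≥0∞) < R n ω
        · rw [kill_of_lt hsn, ← hs, kill_of_lt (hsn.trans_le (hRT n ω))]
        · exact kill_of_le (not_lt.1 hsn)
      have := (hcem t).1 ((hYright n).absorbing ω t hlife)
      rw [kill_of_lt hn] at this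
      exact hne ((kill_of_lt htT).trans this)
    · obtain ⟨n, hx⟩ := hmem x
      filter_upwards [(hYright n).normal ⟨x, hx⟩] with ω hω
      have h := hY n 0 ω
      rw [hω] at h
      obtain ⟨h1, h2⟩ := kill_eq_inl h.symm
      exact (kill_of_lt (h1.trans_le (hRT n ω))).trans h2
    · have : (fun x => P x {ω | kill X T t ω ∈ Sum.inl '' B}) =
          ltransition (kill X T) P t (B.indicator fun _ => 1) := by
        funext x
        rw [ltransition_indicator_const (hZ t) 1 hB, one_mul]
      rw [this]
      exact htr t _ (measurable_indicator_one (𝓐 := univBorel E) hB)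
    · obtain ⟨C, hC⟩ := hC
      refine condExp_of_setLIntegral ((naturalFiltration P (kill X T)).le s) hZ hP
        ((measurable_rawNatural (kill X T) le_rfl).mono (le_augment (rawNatural_le hZ s)) le_rfl)
        (htr t) (fun g hg A hA => ?_) hf hC
      let _ : MeasurableSpace E := borel E
      have : BorelSpace E := ⟨rfl⟩
      -- With the initial law concentrated at `x`, the augmented event `A` is `P x`-a.s. equal to a
      -- raw one.
      obtain ⟨B, hB, hAB⟩ := hA.2 (Measure.dirac x) inferInstance
      rw [ae_dirac_eq] at hAB
      have hAB' : A =ᵐ[P x] B := measure_symmDiff_eq_zero_iff.1 hAB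
      rw [setLIntegral_congr hAB', setLIntegral_congr hAB']
      exact hmk x s t g hg B (rawNatural_le_rawNaturalRight _ _ _ hB)
  refine ⟨hMarkov, fun t => augment_augment _, ?_, fun α hα f hf x => ?_⟩
  · exact isRightContinuous_naturalFiltration fun t B hB =>
      exists_rawNatural_symmDiff_eq_zero hP hZ htr hmk hB
  · obtain ⟨n, hx⟩ := hmem x
    have hex : ∀ k, ∀ᵐ ω ∂(P x), ∀ t, ContinuousWithinAt
        (fun s => extendZero f (kill X (R (k + n)) s ω)) (Ici t) t := by
      intro k
      have h := (hYright (k + n)).excessive_rightContinuous α hα _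
        (hf.restrict_kill hMarkov (hY _) (hYM _) (hRle _) (hRT _)
          (hpos _)) ⟨x, hERmono (Nat.le_add_left n k) hx⟩
      simpa only [extendZero_restrict (hY (k + n))] using h
    filter_upwards [ae_all_iff.2 hex] with ω hω t
    refine continuousWithinAt_kill (extendZero f) fun ht => ?_
    obtain ⟨k, hk⟩ := lt_iSup_iff.1 ht
    have hk' : (t : ℝ≥0∞) < R (k + n) ω := hk.trans_le (hRmono ω (Nat.le_add_right k n))
    refine (hω k t).congr_of_eventuallyEq ?_ (by rw [kill_of_lt hk'])
    have : ∀ᶠ s : ℝ≥0 in 𝓝 t, (s : ℝ≥0∞) < R (k + n) ω :=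
      ENNReal.continuous_coe.continuousAt.eventually (Iio_mem_nhds hk')
    filter_upwards [mem_nhdsWithin_of_mem_nhds this] with s hs
    rw [kill_of_lt hs]
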